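/- **Setting.** Let $\Delta x,\Delta y,R>0$, $\mathcal N_G\in\{1,2,\dots\}$ (grid spacings, communication range, devices per gateway), $\eta>2$ (path-loss exponent), $P>0$ (constant transmit power), $\sigma^2\ge 0$ (noise power), $r_o>0$ (distance of the intended device), $\phi_0\in\mathbb R$ (its direction), $0\le b\le 1$, $n\in\mathbb N$, and let $G(\theta)=1+b\cos(n\theta)$ be the antenna gain. A packet of $L>0$ bits is sent in $m\ge1$ segments, one per slot of length $T_s>0$, at rate $\mathcal R_m=L/(mT_s)=\zeta W\log_2(1+\Xi_m)$ with $\zeta,W>0$; that is, the SINR threshold is $\Xi_m=2^{L/(m\zeta WT_s)}-1$. The test gateway is at the origin of $\mathbb R^2$. The active devices of the other cells form a homogeneous Poisson point process $\{v_j\}$ on $\mathbb R^2$ with intensity $\lambda=\frac{1}{\Delta x\,\Delta y\,\mathcal N_G}$; only those with $\|v_j\|\ge \sqrt3R/2$ interfere. Conditionally on all locations, the orientations $\theta_j$ of the devices relative to the test gateway are independent, $\theta_j$ being uniform on $[\pi/2,3\pi/2]$ if $\|v_j\|\le\sqrt3R$ and uniform on $[0,2\pi]$ if $\|v_j\|>\sqrt3R$.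 The fading gains $h_o,h_1,h_2,\dots$ are i.i.d. exponential with mean $1$ and independent of the locations and orientations. The gateway antenna points in direction $\phi_0$, towards the intended device, whose antenna is perfectly aligned with it, so that $$\mathrm{SINR}=\frac{P\,h_o\,G(0)^2\,r_o^{-\eta}}{\sigma^2+\sum_{j:\,\|v_j\|\ge\sqrt3R/2}P\,h_j\,G(\theta_j)\,G(\arg v_j-\phi_0)\,\|v_j\|^{-\eta}} .$$ **Theorem.** Write $F(x)={}_2F_1\big(1,1-\tfrac2\eta;2-\tfrac2\eta;x\big)$ for the Gauss hypergeometric function, analytically continued to $x<1$, and $g_0=G(0)^2=(1+b)^2$. Then the segment success probability $p_m=\mathbb P\{\mathrm{SINR}>\Xi_m\}$ equals $$p_m=\exp\Bigg\{-\frac{\Xi_m r_o^\eta\sigma^2}{g_0P}-\int_0^{2\pi}\frac{\Xi_m r_o^\eta\,G(\theta_1)\,(\sqrt3R)^{2-\eta}}{4g_0\pi(\eta-2)\,\Delta x\,\Delta y\,\mathcal N_G}\Bigg[\int_0^{2\pi}2G(\theta_2)\,F\Big(\tfrac{-\Xi_m r_o^\eta G(\theta_2)G(\theta_1)}{g_0(\sqrt3R)^\eta}\Big)d\theta_2$$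 $$\qquad+\int_{\pi/2}^{3\pi/2}G(\theta_2)\Big(2^\eta F\Big(\tfrac{-\Xi_m r_o^\eta G(\theta_2)G(\theta_1)}{g_0(\sqrt3R/2)^\eta}\Big)-4F\Big(\tfrac{-\Xi_m r_o^\eta G(\theta_2)G(\theta_1)}{g_0(\sqrt3R)^\eta}\Big)\Big)d\theta_2\Bigg]d\theta_1\Bigg\}.$$ In particular, for $b=1$ (so that the intended link has gain $G(0)^2=4$) the formula holds with $g_0=4$. -/

import Mathlib

open MeasureTheory ProbabilityTheory Real Set
open scoped ENNReal NNReal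

noncomputable section

namespace IoTUplink

/-! ### The Gauss hypergeometric function on `(-∞, 1)` -/

/-- `f` continues the Gauss hypergeometric series `∑ (a)ₖ (b)ₖ / ((c)ₖ k!) xᵏ` real-analytically
from `(-1, 1)` to `(-∞, 1)`. (Mathlib's `₂F₁` is the sum of the series, hence meaningful only for
`|x| < 1`.) -/
def IsGaussContinuation (a b c : ℝ) (f : ℝ → ℝ) : Prop :=
  AnalyticOnNhd ℝ f (Iio 1) ∧ ∀ x ∈ Ioo (-1 : ℝ) 1, f x = ₂F₁ a b c x

open Classical in
/-- The Gauss hypergeometric function `₂F₁(a, b; c; x)` for real `x < 1`: the analytic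
continuation of the Gauss series. It is unique on `(-∞, 1)` by the identity theorem. -/
def gauss2F1 (a b c x : ℝ) : ℝ :=
  if h : ∃ f, IsGaussContinuation a b c f then h.choose x else 0

/-! ### Poisson point processes and independent markings -/

/-- The number (in `[0, ∞]`) of points of the enumerated point process `v` in the set `A`. -/
def pointCount {Ω E : Type*} (v : ℕ → Ω → E) (A : Set E) (ω : Ω) : ℝ≥0∞ :=
  ∑' j, A.indicator (fun _ => (1 : ℝ≥0∞)) (v j ω)

/-- The points `v 0, v 1, …` form a Poisson point process with intensity measure `Λ`: the number of
points in a set of finite intensity `Λ A` is Poisson distributed with mean `Λ A`, and the numbers of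
points in finitely many pairwise disjoint sets are independent. -/
structure IsPoissonPointProcess {Ω E : Type*} [MeasurableSpace Ω] [MeasurableSpace E]
    (v : ℕ → Ω → E) (Λ : Measure E) (μ : Measure Ω) : Prop where
  measurable : ∀ j, Measurable (v j)
  law_count : ∀ A : Set E, MeasurableSet A → Λ A ≠ ∞ →
    HasLaw (pointCount v A)
      ((poissonMeasure (Λ A).toNNReal).map (fun k : ℕ => (k : ℝ≥0∞))) μ
  indep_count : ∀ (k : ℕ) (A : Fin k → Set E), (∀ i, MeasurableSet (A i)) →
    Pairwise (fun i i' => Disjoint (A i) (A i')) →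
    iIndepFun (fun i => pointCount v (A i)) μ

/-- Conditionally on all the points `v`, the marks `θ j` are independent and `θ j` has the
distribution `κ (v j)`. -/
structure IsIndependentMarking {Ω E M : Type*} [MeasurableSpace Ω] [MeasurableSpace E]
    [MeasurableSpace M] (v : ℕ → Ω → E) (θ : ℕ → Ω → M) (κ : E → Measure M) (μ : Measure Ω) :
    Prop where
  measurable : ∀ j, Measurable (θ j)
  cond_law : ∀ (J : Finset ℕ) (C : Set (ℕ → E)) (B : ℕ → Set M),
    MeasurableSet C → (∀ j, MeasurableSet (B j)) →
    μ {ω | (fun j => v j ω) ∈ C ∧ ∀ j ∈ J, θ j ω ∈ B j} =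
      ∫⁻ ω in {ω | (fun j => v j ω) ∈ C}, ∏ j ∈ J, κ (v j ω) (B j) ∂μ

/-! ### The network -/

/-- Antenna gain `G(θ) = 1 + b cos(nθ)`. -/
def gain (b : ℝ) (n : ℕ) (θ : ℝ) : ℝ := 1 + b * cos (n * θ)

/-- Transmission rate when a packet of `L` bits is cut into `m` segments, each sent in one slot of
length `Ts`. -/
def txRate (L : ℝ) (m : ℕ) (Ts : ℝ) : ℝ := L / (m * Ts)

/-- The SINR threshold `Ξ` at rate `rate`, i.e. the solution of `rate = ζ W log₂ (1 + Ξ)`. -/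
def sinrThreshold (ζ W rate : ℝ) : ℝ := 2 ^ (rate / (ζ * W)) - 1

/-- Intensity of active devices per unit area. -/
def activeDensity (Δx Δy : ℝ) (NG : ℕ) : ℝ := 1 / (Δx * Δy * NG)

/-- Distribution of the antenna orientation (relative to the direction of the test gateway at `0`)
of an interfering device located at `z`. -/
def orientationLaw (R : ℝ) (z : ℂ) : Measure ℝ :=
  if ‖z‖ ≤ √3 * R then cond volume (Icc (π / 2) (3 * π / 2)) else cond volume (Icc 0 (2 * π))

/-- The random input of the two-dimensional Poisson model. The plane is `ℂ`, the test gateway is at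
`0`, and `v j`, `θ j`, `h j` are the location, the orientation and the fading gain of the `j`-th
active device; `h₀` is the fading gain of the intended link. -/
structure IsPoissonModel {Ω : Type*} [MeasurableSpace Ω] (μ : Measure Ω) (lam R : ℝ)
    (v : ℕ → Ω → ℂ) (θ h : ℕ → Ω → ℝ) (h₀ : Ω → ℝ) : Prop where
  locations : IsPoissonPointProcess v (ENNReal.ofReal lam • (volume : Measure ℂ)) μ
  orientations : IsIndependentMarking v θ (orientationLaw R) μ
  measurable_fading : ∀ j, Measurable (h j)
  law_fading : ∀ j, HasLaw (h j) (expMeasure 1) μ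
  indep_fading : iIndepFun h μ
  indep_fading_devices : IndepFun (fun ω j => h j ω)
    (fun ω => ((fun j => v j ω : ℕ → ℂ), (fun j => θ j ω : ℕ → ℝ))) μ
  measurable_fading₀ : Measurable h₀
  law_fading₀ : HasLaw h₀ (expMeasure 1) μ
  indep_fading₀ : IndepFun h₀
    (fun ω => ((fun j => h j ω : ℕ → ℝ), (fun j => v j ω : ℕ → ℂ), (fun j => θ j ω : ℕ → ℝ))) μ

/-- Aggregate interference power at the test gateway. Devices closer than `√3 R / 2` do not
interfere; the gateway antenna points in direction `φ₀`, so that a device at `z` is seen under the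
angle `arg z - φ₀`. -/
def interference {Ω : Type*} (P η R b : ℝ) (n : ℕ) (φ₀ : ℝ)
    (v : ℕ → Ω → ℂ) (θ h : ℕ → Ω → ℝ) (ω : Ω) : ℝ≥0∞ :=
  ∑' j, {z : ℂ | √3 * R / 2 ≤ ‖z‖}.indicator
    (fun z => ENNReal.ofReal
      (P * h j ω * gain b n (θ j ω) * gain b n (z.arg - φ₀) * ‖z‖ ^ (-η))) (v j ω)

/-- Signal to interference and noise ratio of an intended device at distance `r₀`, whose antenna
and the gateway's antenna are perfectly aligned. -/
def sinr {Ω : Type*} (P σ η R b : ℝ) (n : ℕ) (φ₀ r₀ : ℝ)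
    (v : ℕ → Ω → ℂ) (θ h : ℕ → Ω → ℝ) (h₀ : Ω → ℝ) (ω : Ω) : ℝ≥0∞ :=
  ENNReal.ofReal (P * h₀ ω * gain b n 0 * gain b n 0 * r₀ ^ (-η)) /
    (ENNReal.ofReal (σ ^ 2) + interference P η R b n φ₀ v θ h ω)

/-- The segment success probability `ℙ(SINR > Ξ)`. -/
def successProb {Ω : Type*} [MeasurableSpace Ω] (μ : Measure Ω) (Ξ P σ η R b : ℝ) (n : ℕ)
    (φ₀ r₀ : ℝ) (v : ℕ → Ω → ℂ) (θ h : ℕ → Ω → ℝ) (h₀ : Ω → ℝ) : ℝ :=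
  μ.real {ω | ENNReal.ofReal Ξ < sinr P σ η R b n φ₀ r₀ v θ h h₀ ω}

/-- The function `₂F₁(1, 1 - 2/η; 2 - 2/η; x)`. -/
def hyp (η x : ℝ) : ℝ := gauss2F1 1 (1 - 2 / η) (2 - 2 / η) x

/-- The closed form of the success probability; `g₀` is the gain product of the intended link. -/
def successFormula (g₀ Ξ P σ η R b : ℝ) (n : ℕ) (r₀ Δx Δy : ℝ) (NG : ℕ) : ℝ :=
  exp (-(Ξ * r₀ ^ η * σ ^ 2 / (g₀ * P)) -
    ∫ θ₁ in (0)..(2 * π),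
      Ξ * r₀ ^ η * gain b n θ₁ * (√3 * R) ^ (2 - η) /
          (4 * g₀ * π * (η - 2) * Δx * Δy * NG) *
        ((∫ θ₂ in (0)..(2 * π), 2 * gain b n θ₂ *
            hyp η (-(Ξ * r₀ ^ η * gain b n θ₂ * gain b n θ₁) / (g₀ * (√3 * R) ^ η))) +
          ∫ θ₂ in (π / 2)..(3 * π / 2), gain b n θ₂ *
            (2 ^ η * hyp η
                (-(Ξ * r₀ ^ η * gain b n θ₂ * gain b n θ₁) / (g₀ * (√3 * R / 2) ^ η)) -
              4 * hyp η
                (-(Ξ * r₀ ^ η * gain b n θ₂ * gain b n θ₁) / (g₀ * (√3 * R) ^ η)))))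

end IoTUplink

end

/-
Since the fading gain of the intended link is exponential, `ℙ(SINR > Ξ)` is the Laplace transform of
noise plus interference. The fading and the orientations are independent marks of a Poisson process,
so the Laplace functional gives `exp (-∫∫ q / (1 + q))` for the interference, where `q (z, t)` is
the scaled mean power received from a device at `z` with orientation `t`: the `1 / (1 + q)` is the
Laplace transform of an exponential mark. In polar coordinates the radial integrals have the form
`∫_{r > a} r · c r^(-η) / (1 + c r^(-η)) dr`, and these are hypergeometric because, for `T` with
moments `𝔼 Tⁿ = β / (β + n)`, the function `x ↦ 𝔼 (1 - x T)⁻¹` is analytic on `(-∞, 1)` and has the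
power series of `₂F₁(1, β; β + 1; x)` at `0`; here `T = (U / a)^(-η)` with `U` Pareto distributed
on `(a, ∞)`.
-/

namespace IoTUplink

section PowerMoments

variable {X : Type*} [MeasurableSpace X] {ν : Measure X} {T : X → ℝ} {β ε t x : ℝ} {z : ℂ}

theorem le_norm_one_sub_mul (hε : ε ≤ 1) (hz : z.re ≤ 1 - ε) (ht : t ∈ Icc (0 : ℝ) 1) :
    ε ≤ ‖1 - z * t‖ := by
  refine le_trans ?_ (Complex.re_le_norm _)
  simp only [Complex.sub_re, Complex.one_re, Complex.mul_re, Complex.ofReal_re, Complex.ofReal_im,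
    mul_zero, sub_zero]
  nlinarith [ht.1, ht.2]

theorem one_sub_mul_inv_mem_Icc (hx : x ≤ 0) (ht : 0 ≤ t) :
    (1 - x * t)⁻¹ ∈ Icc (0 : ℝ) 1 := by
  have : 1 ≤ 1 - x * t := by linarith [mul_nonpos_of_nonpos_of_nonneg hx ht]
  exact ⟨by positivity, inv_le_one_of_one_le₀ this⟩

theorem hasDerivAt_one_sub_mul_inv (h : 1 - z * t ≠ 0) :
    HasDerivAt (fun w : ℂ => (1 - w * t)⁻¹) (t / (1 - z * t) ^ 2) z := by
  have hlin : HasDerivAt (fun w : ℂ => 1 - w * t) (-t) z := by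
    simpa using ((hasDerivAt_id z).mul_const (t : ℂ)).const_sub 1
  exact (hlin.inv h).congr_deriv (by rw [neg_neg])

theorem differentiableAt_integral_one_sub_mul_inv [IsFiniteMeasure ν] (hTm : Measurable T)
    (hT : ∀ᵐ a ∂ν, T a ∈ Icc (0 : ℝ) 1) (hz : z.re < 1) :
    DifferentiableAt ℂ (fun w : ℂ => ∫ a, (1 - w * T a)⁻¹ ∂ν) z := by
  obtain ⟨ε, hε₀, hε₁, hzε⟩ : ∃ ε : ℝ, 0 < ε ∧ ε ≤ 1 ∧ z.re < 1 - ε := by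
    refine ⟨min ((1 - z.re) / 2) 1, lt_min (by linarith) one_pos, min_le_right _ _, ?_⟩
    linarith [min_le_left ((1 - z.re) / 2) 1]
  have hs : {w : ℂ | w.re < 1 - ε} ∈ nhds z :=
    (isOpen_lt Complex.continuous_re continuous_const).mem_nhds hzε
  have hden : ∀ᵐ a ∂ν, ∀ w ∈ {w : ℂ | w.re < 1 - ε}, ε ≤ ‖1 - w * T a‖ := by
    filter_upwards [hT] with a ha w hw using le_norm_one_sub_mul hε₁ hw.le ha
  refine (hasDerivAt_integral_of_dominated_loc_of_deriv_le (μ := ν) (x₀ := z)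
    (F := fun (w : ℂ) a => (1 - w * T a)⁻¹) (F' := fun (w : ℂ) a => (T a : ℂ) / (1 - w * T a) ^ 2)
    (bound := fun _ => 1 / ε ^ 2) hs ?_ ?_ ?_ ?_ ?_ ?_).2.differentiableAt
  · exact .of_forall fun w => Measurable.aestronglyMeasurable (by fun_prop)
  · refine (integrable_const ε⁻¹).mono' (Measurable.aestronglyMeasurable (by fun_prop)) ?_
    filter_upwards [hden] with a ha
    rw [norm_inv]
    exact inv_anti₀ hε₀ (ha z hzε)
  · exact Measurable.aestronglyMeasurable (by fun_prop)
  · filter_upwards [hT, hden] with a ha hda w hw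
    rw [norm_div, norm_pow, Complex.norm_real, Real.norm_of_nonneg ha.1]
    have := hda w hw
    gcongr
    exact ha.2
  · exact integrable_const _
  · filter_upwards [hden] with a ha w hw
    exact hasDerivAt_one_sub_mul_inv (norm_pos_iff.1 (hε₀.trans_le (ha w hw)))

theorem analyticOnNhd_integral_one_sub_mul_inv [IsFiniteMeasure ν] (hTm : Measurable T)
    (hT : ∀ᵐ a ∂ν, T a ∈ Icc (0 : ℝ) 1) :
    AnalyticOnNhd ℝ (fun x : ℝ => ∫ a, (1 - x * T a)⁻¹ ∂ν) (Iio 1) := by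
  intro x hx
  have hopen : IsOpen {z : ℂ | z.re < 1} := isOpen_lt Complex.continuous_re continuous_const
  have hcomplex : AnalyticAt ℂ (fun z : ℂ => ∫ a, (1 - z * T a)⁻¹ ∂ν) (x : ℂ) :=
    DifferentiableOn.analyticAt (s := {z : ℂ | z.re < 1})
      (fun z hz =>
        (differentiableAt_integral_one_sub_mul_inv hTm hT hz).differentiableWithinAt)
      (hopen.mem_nhds (by simpa using hx))
  refine hcomplex.re_ofReal.congr (.of_forall fun y => ?_)
  have hcast : ∀ a, (1 - (y : ℂ) * T a)⁻¹ = (((1 - y * T a)⁻¹ : ℝ) : ℂ) := fun a => by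
    push_cast; rfl
  simp only [hcast]
  rw [integral_complex_ofReal, Complex.ofReal_re]

theorem hasSum_integral_one_sub_mul_inv [IsFiniteMeasure ν] (hTm : Measurable T)
    (hT : ∀ᵐ a ∂ν, T a ∈ Icc (0 : ℝ) 1) (hx : |x| < 1) :
    HasSum (fun n : ℕ => x ^ n * ∫ a, T a ^ n ∂ν) (∫ a, (1 - x * T a)⁻¹ ∂ν) := by
  have hpow : ∀ n : ℕ, ∀ᵐ a ∂ν, ‖(x * T a) ^ n‖ ≤ |x| ^ n := fun n => by
    filter_upwards [hT] with a ha
    rw [norm_pow, norm_mul, Real.norm_eq_abs, Real.norm_of_nonneg ha.1]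
    exact pow_le_pow_left₀ (mul_nonneg (abs_nonneg x) ha.1)
      (mul_le_of_le_one_right (abs_nonneg x) ha.2) n
  have hsum := hasSum_integral_of_dominated_convergence (μ := ν)
    (F := fun n a => (x * T a) ^ n) (f := fun a => (1 - x * T a)⁻¹) (fun n _ => |x| ^ n)
    (fun n => Measurable.aestronglyMeasurable (by fun_prop)) hpow
    (.of_forall fun _ => summable_geometric_of_lt_one (abs_nonneg x) hx)
    (integrable_const _) ?_
  · simpa only [mul_pow, integral_const_mul] using hsum
  · filter_upwards [hpow 1] with a ha
    rw [pow_one, pow_one] at ha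
    exact hasSum_geometric_of_abs_lt_one (ha.trans_lt hx)

theorem gauss_coeff_one (hβ : 0 < β) (n : ℕ) :
    ((n.factorial : ℝ)⁻¹ * (ascPochhammer ℝ n).eval 1 * (ascPochhammer ℝ n).eval β *
      ((ascPochhammer ℝ n).eval (β + 1))⁻¹) = β / (β + n) := by
  have hshift : (ascPochhammer ℝ n).eval β * (β + n) =
      β * (ascPochhammer ℝ n).eval (β + 1) := by
    rw [← ascPochhammer_succ_eval, ascPochhammer_succ_left]
    simp
  have hpos : 0 < (ascPochhammer ℝ n).eval (β + 1) := ascPochhammer_pos n _ (by linarith)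
  rw [ascPochhammer_eval_one, inv_mul_cancel₀ (by positivity), one_mul, ← div_eq_mul_inv,
    div_eq_div_iff hpos.ne' (by positivity), hshift]

/- `β / (β + n)` is both the `n`-th moment of the distribution of `T` and the `n`-th coefficient of
the series of `₂F₁(1, β; β + 1; x)`. -/
theorem isGaussContinuation_of_moments [IsFiniteMeasure ν] (hβ : 0 < β) (hTm : Measurable T)
    (hT : ∀ᵐ a ∂ν, T a ∈ Icc (0 : ℝ) 1) (hmom : ∀ n : ℕ, ∫ a, T a ^ n ∂ν = β / (β + n)) :
    IsGaussContinuation 1 β (β + 1) fun x => ∫ a, (1 - x * T a)⁻¹ ∂ν := by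
  refine ⟨analyticOnNhd_integral_one_sub_mul_inv hTm hT, fun x hx => ?_⟩
  beta_reduce
  rw [← (hasSum_integral_one_sub_mul_inv hTm hT (abs_lt.2 hx)).tsum_eq,
    ordinaryHypergeometric_eq_tsum]
  exact tsum_congr fun n => by rw [gauss_coeff_one hβ, hmom, smul_eq_mul, mul_comm]

theorem IsGaussContinuation.eqOn_gauss2F1 {a b c : ℝ} {f : ℝ → ℝ}
    (hf : IsGaussContinuation a b c f) : EqOn (gauss2F1 a b c) f (Iio 1) := by
  have hex : ∃ f, IsGaussContinuation a b c f := ⟨f, hf⟩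
  have hchoose : gauss2F1 a b c = hex.choose := funext fun x => by rw [gauss2F1, dif_pos hex]
  rw [hchoose]
  refine hex.choose_spec.1.eqOn_of_preconnected_of_eventuallyEq hf.1 isPreconnected_Iio
    (z₀ := 0) (by simp) ?_
  filter_upwards [Ioo_mem_nhds (a := (-1 : ℝ)) (b := 1) (by norm_num) (by norm_num)] with y hy
  rw [hex.choose_spec.2 y hy, hf.2 y hy]

end PowerMoments

section Pareto

variable {η a c x : ℝ}

theorem paretoMeasure_eq_withDensity (t r : ℝ) :
    paretoMeasure t r = (volume.restrict (Ioi t)).withDensity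
      fun u => ENNReal.ofReal (r * t ^ r * u ^ (-(r + 1))) := by
  rw [paretoMeasure, ← withDensity_indicator measurableSet_Ioi]
  refine withDensity_congr_ae ?_
  filter_upwards [Measure.ae_ne volume t] with u hne
  rcases lt_or_gt_of_ne hne with hu | hu
  · rw [paretoPDF_of_lt hu, indicator_of_notMem (notMem_Ioi.2 hu.le)]
  · rw [paretoPDF_of_le hu.le, indicator_of_mem (mem_Ioi.2 hu)]

theorem ae_paretoMeasure_mem_Ioi (t r : ℝ) : ∀ᵐ u ∂paretoMeasure t r, u ∈ Ioi t := by
  rw [paretoMeasure_eq_withDensity]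
  exact withDensity_absolutelyContinuous _ _ (ae_restrict_mem measurableSet_Ioi)

theorem lintegral_paretoMeasure (t r : ℝ) {f : ℝ → ℝ≥0∞} (hf : Measurable f) :
    ∫⁻ u, f u ∂paretoMeasure t r =
      ∫⁻ u in Ioi t, ENNReal.ofReal (r * t ^ r * u ^ (-(r + 1))) * f u := by
  rw [paretoMeasure_eq_withDensity, lintegral_withDensity_eq_lintegral_mul _ (by fun_prop) hf]
  rfl

theorem div_rpow_neg_mem_Icc (hη : 0 ≤ η) (ha : 0 < a) {u : ℝ} (hu : u ∈ Ioi a) :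
    (u / a) ^ (-η) ∈ Icc (0 : ℝ) 1 := by
  have : 1 ≤ u / a := (one_le_div ha).2 (le_of_lt hu)
  exact ⟨by positivity, rpow_le_one_of_one_le_of_nonpos this (by linarith)⟩

theorem integral_div_rpow_paretoMeasure {t r s : ℝ} (ht : 0 < t) (hr : 0 < r) (hs : 0 ≤ s) :
    ∫ u, (u / t) ^ (-s) ∂paretoMeasure t r = r / (r + s) := by
  have hdensity : ∀ u ∈ Ioi t,
      (ENNReal.ofReal (r * t ^ r * u ^ (-(r + 1)))).toReal • (u / t) ^ (-s) =
        r * t ^ (r + s) * u ^ (-(r + s) - 1) := fun u hu => by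
    have hu₀ : 0 < u := ht.trans hu
    rw [ENNReal.toReal_ofReal (by positivity), smul_eq_mul, div_rpow hu₀.le ht.le,
      rpow_neg ht.le s, div_inv_eq_mul, rpow_add ht,
      show -(r + s) - 1 = -(r + 1) + -s by ring, rpow_add hu₀]
    ring
  rw [paretoMeasure_eq_withDensity, integral_withDensity_eq_integral_toReal_smul (by fun_prop)
    (.of_forall fun _ => ENNReal.ofReal_lt_top), setIntegral_congr_fun measurableSet_Ioi hdensity,
    integral_const_mul, integral_Ioi_rpow_of_lt (by linarith) ht, sub_add_cancel, rpow_neg ht.le]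
  field_simp

theorem isGaussContinuation_pareto (hη : 2 < η) (ha : 0 < a) :
    IsGaussContinuation 1 (1 - 2 / η) (2 - 2 / η)
      fun x => ∫ u, (1 - x * (u / a) ^ (-η))⁻¹ ∂paretoMeasure a (η - 2) := by
  have hη₀ : 0 < η := by linarith
  have hr : 0 < η - 2 := by linarith
  have := isProbabilityMeasure_paretoMeasure ha hr
  rw [show 2 - 2 / η = 1 - 2 / η + 1 by ring]
  refine isGaussContinuation_of_moments (by rw [sub_pos, div_lt_one hη₀]; exact hη) (by fun_prop) ?_
    fun n => ?_
  · filter_upwards [ae_paretoMeasure_mem_Ioi a (η - 2)] with u hu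
      using div_rpow_neg_mem_Icc hη₀.le ha hu
  · have hpow : ∀ᵐ u ∂paretoMeasure a (η - 2), ((u / a) ^ (-η)) ^ n = (u / a) ^ (-(η * n)) := by
      filter_upwards [ae_paretoMeasure_mem_Ioi a (η - 2)] with u hu
      rw [← rpow_mul_natCast (div_pos (ha.trans hu) ha).le, neg_mul]
    rw [integral_congr_ae hpow, integral_div_rpow_paretoMeasure ha hr (by positivity)]
    have : η - 2 + η * n ≠ 0 := by positivity
    have : 1 - 2 / η + n ≠ 0 := by
      rw [show 1 - 2 / η + n = (η - 2 + η * n) / η by field_simp]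
      positivity
    rw [div_eq_div_iff (by positivity) (by positivity)]
    field_simp

theorem hyp_eq_integral_pareto (hη : 2 < η) (ha : 0 < a) (hx : x < 1) :
    hyp η x = ∫ u, (1 - x * (u / a) ^ (-η))⁻¹ ∂paretoMeasure a (η - 2) :=
  (isGaussContinuation_pareto hη ha).eqOn_gauss2F1 hx

theorem continuousOn_hyp (hη : 2 < η) : ContinuousOn (hyp η) (Iio 1) :=
  (isGaussContinuation_pareto hη one_pos).1.continuousOn.congr
    (isGaussContinuation_pareto hη one_pos).eqOn_gauss2F1

/-- The value of `∫_{r > a} r · c r^(-η) / (1 + c r^(-η)) dr`: the contribution of the sources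
beyond distance `a` in one direction to the exponent of the Laplace transform of the
interference, when a source at distance `r` has relative mean power `c r^(-η)`. -/
noncomputable def radialTail (η a c : ℝ) : ℝ :=
  c * a ^ (2 - η) / (η - 2) * hyp η (-c / a ^ η)

theorem neg_div_rpow_nonpos (ha : 0 < a) (hc : 0 ≤ c) : -c / a ^ η ≤ 0 :=
  div_nonpos_of_nonpos_of_nonneg (neg_nonpos.2 hc) (rpow_nonneg ha.le η)

/- The integrand is a multiple of the Pareto density with exponent `η - 2` on `(a, ∞)` times
`(1 + c r^(-η))⁻¹`. -/
theorem lintegral_Ioi_eq_radialTail (hη : 2 < η) (ha : 0 < a) (hc : 0 ≤ c) :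
    ∫⁻ r in Ioi a, ENNReal.ofReal r * ENNReal.ofReal (c * r ^ (-η) / (1 + c * r ^ (-η))) =
      ENNReal.ofReal (radialTail η a c) := by
  have hη₂ : 0 < η - 2 := by linarith
  have := isProbabilityMeasure_paretoMeasure ha hη₂
  have hx : -c / a ^ η ≤ 0 := neg_div_rpow_nonpos ha hc
  have hmem : ∀ᵐ u ∂paretoMeasure a (η - 2),
      (1 - -c / a ^ η * (u / a) ^ (-η))⁻¹ ∈ Icc (0 : ℝ) 1 := by
    filter_upwards [ae_paretoMeasure_mem_Ioi a (η - 2)] with u hu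
    exact one_sub_mul_inv_mem_Icc hx (rpow_nonneg (div_pos (ha.trans hu) ha).le _)
  have hint : Integrable (fun u => (1 - -c / a ^ η * (u / a) ^ (-η))⁻¹)
      (paretoMeasure a (η - 2)) :=
    (integrable_const 1).mono' (Measurable.aestronglyMeasurable (by fun_prop))
      (hmem.mono fun u hu => (Real.norm_of_nonneg hu.1).trans_le hu.2)
  rw [radialTail, hyp_eq_integral_pareto hη ha (hx.trans_lt one_pos),
    ENNReal.ofReal_mul (by positivity),
    ofReal_integral_eq_lintegral_ofReal hint (hmem.mono fun _ hu => hu.1),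
    lintegral_paretoMeasure _ _ (by fun_prop), ← lintegral_const_mul' _ _ ENNReal.ofReal_ne_top]
  refine setLIntegral_congr_fun measurableSet_Ioi fun u hu => ?_
  have hu₀ : 0 < u := ha.trans hu
  have hrel : 1 - -c / a ^ η * (u / a) ^ (-η) = 1 + c * u ^ (-η) := by
    rw [div_rpow hu₀.le ha.le, rpow_neg ha.le]
    field_simp
    ring
  rw [hrel, ← ENNReal.ofReal_mul hu₀.le, ← ENNReal.ofReal_mul (by positivity),
    ← ENNReal.ofReal_mul (by positivity), show -(η - 2 + 1) = -η + 1 by ring,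
    rpow_add_one hu₀.ne', show 2 - η = -(η - 2) by ring, rpow_neg ha.le (η - 2)]
  congr 1
  field_simp

end Pareto

section RadialTail

variable {η a a' c x : ℝ}

theorem hyp_nonneg (hη : 2 < η) (hx : x ≤ 0) : 0 ≤ hyp η x := by
  rw [hyp_eq_integral_pareto hη one_pos (hx.trans_lt one_pos)]
  refine integral_nonneg_of_ae ?_
  filter_upwards [ae_paretoMeasure_mem_Ioi 1 (η - 2)] with u hu
  exact (one_sub_mul_inv_mem_Icc hx (rpow_nonneg (div_pos (one_pos.trans hu) one_pos).le _)).1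

theorem radialTail_nonneg (hη : 2 < η) (ha : 0 < a) (hc : 0 ≤ c) : 0 ≤ radialTail η a c :=
  mul_nonneg (div_nonneg (by positivity) (by linarith))
    (hyp_nonneg hη (neg_div_rpow_nonpos ha hc))

theorem radialTail_anti (hη : 2 < η) (ha : 0 < a) (haa' : a ≤ a') (hc : 0 ≤ c) :
    radialTail η a' c ≤ radialTail η a c := by
  rw [← ENNReal.ofReal_le_ofReal_iff (radialTail_nonneg hη ha hc),
    ← lintegral_Ioi_eq_radialTail hη ha hc,
    ← lintegral_Ioi_eq_radialTail hη (ha.trans_le haa') hc]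
  exact lintegral_mono_set (Ioi_subset_Ioi haa')

theorem continuous_radialTail {X : Type*} [TopologicalSpace X] (hη : 2 < η) (ha : 0 < a)
    {f : X → ℝ} (hf : Continuous f) (hf₀ : ∀ x, 0 ≤ f x) :
    Continuous fun x => radialTail η a (f x) := by
  have hhyp : Continuous fun x => hyp η (-f x / a ^ η) :=
    (continuousOn_hyp hη).comp_continuous (by fun_prop) fun x =>
      (neg_div_rpow_nonpos ha (hf₀ x)).trans_lt one_pos
  unfold radialTail
  fun_prop

theorem lintegral_Icc_eq_radialTail_sub (hη : 2 < η) (ha : 0 < a) (haa' : a ≤ a') (hc : 0 ≤ c) :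
    ∫⁻ r in Icc a a', ENNReal.ofReal r * ENNReal.ofReal (c * r ^ (-η) / (1 + c * r ^ (-η))) =
      ENNReal.ofReal (radialTail η a c - radialTail η a' c) := by
  have ha' := ha.trans_le haa'
  have hsplit := lintegral_Ioi_eq_radialTail hη ha hc
  rw [← Ioc_union_Ioi_eq_Ioi haa', lintegral_union measurableSet_Ioi
    (Ioc_disjoint_Ioi le_rfl), lintegral_Ioi_eq_radialTail hη ha' hc,
    setLIntegral_congr Ioc_ae_eq_Icc] at hsplit
  rw [ENNReal.ofReal_sub _ (radialTail_nonneg hη ha' hc), ← hsplit,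
    ENNReal.add_sub_cancel_right ENNReal.ofReal_ne_top]

end RadialTail

section ExpNeg

/-- The function `exp (-t)` on `[0, ∞]`, with value `0` at `∞`. Laplace transforms of sums of
nonnegative terms are expressed through it, so that no summability has to be assumed. -/
noncomputable def expNeg (t : ℝ≥0∞) : ℝ≥0∞ := EReal.exp (-(t : EReal))

theorem continuous_expNeg : Continuous expNeg :=
  EReal.expHomeomorph.continuous.comp (continuous_neg.comp continuous_coe_ennreal_ereal)

@[fun_prop]
theorem measurable_expNeg : Measurable expNeg := continuous_expNeg.measurable

theorem antitone_expNeg : Antitone expNeg := fun _ _ h =>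
  EReal.exp_monotone (EReal.neg_le_neg_iff.2 (EReal.coe_ennreal_le_coe_ennreal_iff.2 h))

@[simp] theorem expNeg_zero : expNeg 0 = 1 := by simp [expNeg]

@[simp] theorem expNeg_top : expNeg ∞ = 0 := by simp [expNeg]

theorem expNeg_le_one (t : ℝ≥0∞) : expNeg t ≤ 1 := expNeg_zero ▸ antitone_expNeg (zero_le (a := t))

theorem expNeg_ofReal {x : ℝ} (hx : 0 ≤ x) :
    expNeg (ENNReal.ofReal x) = ENNReal.ofReal (exp (-x)) := by
  rw [expNeg, EReal.coe_ennreal_ofReal, max_eq_left hx, ← EReal.coe_neg, EReal.exp_coe]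

theorem expNeg_add (s t : ℝ≥0∞) : expNeg (s + t) = expNeg s * expNeg t := by
  simp only [expNeg, EReal.exp_neg, EReal.coe_ennreal_add, EReal.exp_add]
  refine ENNReal.mul_inv (Or.inl ?_) (Or.inr ?_) <;> simp

theorem expNeg_sum {ι : Type*} (s : Finset ι) (f : ι → ℝ≥0∞) :
    expNeg (∑ i ∈ s, f i) = ∏ i ∈ s, expNeg (f i) := by
  classical
  induction s using Finset.induction_on with
  | empty => simp
  | insert i s hi ih => rw [Finset.sum_insert hi, Finset.prod_insert hi, expNeg_add, ih]

theorem expNeg_mul_natCast (t : ℝ≥0∞) (k : ℕ) : expNeg (t * k) = expNeg t ^ k := by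
  simpa [mul_comm] using expNeg_sum (Finset.range k) fun _ => t

variable {Ω : Type*} [MeasurableSpace Ω] {μ : Measure Ω} [IsFiniteMeasure μ]

theorem tendsto_lintegral_expNeg {f : ℕ → Ω → ℝ≥0∞} {g : Ω → ℝ≥0∞} (hf : ∀ n, Measurable (f n))
    (hlim : ∀ ω, Filter.Tendsto (fun n => f n ω) Filter.atTop (nhds (g ω))) :
    Filter.Tendsto (fun n => ∫⁻ ω, expNeg (f n ω) ∂μ) Filter.atTop
      (nhds (∫⁻ ω, expNeg (g ω) ∂μ)) :=
  tendsto_lintegral_of_dominated_convergence (fun _ => 1)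
    (fun n => measurable_expNeg.comp (hf n)) (fun _ => .of_forall fun _ => expNeg_le_one _)
    (by simp) (.of_forall fun ω => (continuous_expNeg.tendsto _).comp (hlim ω))

theorem tendsto_lintegral_prod_expNeg {f : ℕ → Ω → ℝ≥0∞} (hf : ∀ j, Measurable (f j)) :
    Filter.Tendsto (fun N => ∫⁻ ω, ∏ j ∈ Finset.range N, expNeg (f j ω) ∂μ) Filter.atTop
      (nhds (∫⁻ ω, expNeg (∑' j, f j ω) ∂μ)) := by
  simp only [← expNeg_sum]
  exact tendsto_lintegral_expNeg (fun N => Finset.measurable_sum _ fun j _ => hf j)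
    fun ω => ENNReal.summable.hasSum.tendsto_sum_nat

/-- The inverse of `expNeg` on `[0, 1]`. -/
noncomputable def negLog (s : ℝ≥0∞) : ℝ≥0∞ := (-ENNReal.log s).toENNReal

theorem expNeg_negLog {s : ℝ≥0∞} (hs : s ≤ 1) : expNeg (negLog s) = s := by
  have : 0 ≤ -ENNReal.log s := by
    rw [EReal.le_neg, neg_zero, ← ENNReal.log_one]
    exact ENNReal.log_monotone hs
  rw [expNeg, negLog, EReal.coe_toENNReal this, neg_neg, ENNReal.exp_log]

@[fun_prop]
theorem measurable_negLog : Measurable negLog := by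
  unfold negLog
  fun_prop

end ExpNeg

section PoissonProcess

open Filter

theorem lintegral_pow_poissonMeasure (r : ℝ≥0) {q : ℝ≥0∞} (hq : q ≤ 1) :
    ∫⁻ k : ℕ, q ^ k ∂poissonMeasure r = expNeg (r * (1 - q)) := by
  lift q to ℝ≥0 using ne_top_of_le_ne_top ENNReal.one_ne_top hq
  have hq' : (q : ℝ) ≤ 1 := by exact_mod_cast hq
  have hterm : ∀ k : ℕ, ENNReal.ofReal (exp (-r) * r ^ k / k.factorial) * (q : ℝ≥0∞) ^ k =
      ENNReal.ofReal (exp (-(r * (1 - q))) *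
        (exp (-(r * q : ℝ≥0)) * (r * q : ℝ≥0) ^ k / k.factorial)) := fun k => by
    have hexp : exp (-(r : ℝ)) = exp (-(r * (1 - q))) * exp (-((r * q : ℝ≥0) : ℝ)) := by
      rw [← exp_add]; push_cast; congr 1; ring
    rw [← ENNReal.ofReal_coe_nnreal (p := q), ← ENNReal.ofReal_pow q.coe_nonneg,
      ← ENNReal.ofReal_mul (by positivity), hexp]
    push_cast
    rw [mul_pow]
    congr 1
    ring
  have hsum := (hasSum_one_poissonMeasure (r * q)).mul_left (exp (-((r : ℝ) * (1 - q))))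
  rw [poissonMeasure, lintegral_sum_measure]
  simp only [lintegral_smul_measure, lintegral_dirac, smul_eq_mul, hterm]
  rw [← ENNReal.ofReal_tsum_of_nonneg (fun k => by positivity) hsum.summable, hsum.tsum_eq, mul_one,
    ← expNeg_ofReal (mul_nonneg r.coe_nonneg (sub_nonneg.2 hq')),
    ENNReal.ofReal_mul r.coe_nonneg, ENNReal.ofReal_sub _ q.coe_nonneg]
  simp only [ENNReal.ofReal_coe_nnreal, ENNReal.ofReal_one]

variable {Ω E ι : Type*} [MeasurableSpace E] {v : ℕ → Ω → E}

theorem tsum_simpleFunc_eq_sum_pointCount (s : SimpleFunc E ℝ≥0∞) (ω : Ω) :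
    ∑' j, s (v j ω) = ∑ y ∈ s.range, y * pointCount v (s ⁻¹' {y}) ω := by
  have hcount : ∀ y, pointCount v (s ⁻¹' {y}) ω =
      (Measure.sum fun j => Measure.dirac (v j ω)) (s ⁻¹' {y}) := fun y => by
    rw [Measure.sum_apply _ (s.measurableSet_fiber y)]
    exact tsum_congr fun j => (Measure.dirac_apply' _ (s.measurableSet_fiber y)).symm
  simp only [hcount]
  rw [← SimpleFunc.lintegral, ← SimpleFunc.lintegral_eq_lintegral, lintegral_sum_measure]
  exact tsum_congr fun j => (lintegral_dirac' _ s.measurable).symm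

variable [MeasurableSpace Ω] {Λ : Measure E} {μ : Measure Ω}

theorem measurable_pointCount (hv : ∀ j, Measurable (v j)) {A : Set E} (hA : MeasurableSet A) :
    Measurable (pointCount v A) :=
  Measurable.tsum fun j => (measurable_const.indicator hA).comp (hv j)

namespace IsPoissonPointProcess

theorem lintegral_expNeg_pointCount (hv : IsPoissonPointProcess v Λ μ)
    {A : Set E} (hA : MeasurableSet A) (hΛ : Λ A ≠ ∞) (a : ℝ≥0∞) :
    ∫⁻ ω, expNeg (a * pointCount v A ω) ∂μ = expNeg (Λ A * (1 - expNeg a)) := by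
  have hm : Measurable fun t : ℝ≥0∞ => expNeg (a * t) := by fun_prop
  rw [(hv.law_count A hA hΛ).lintegral_comp hm.aemeasurable,
    lintegral_map hm (measurable_of_countable _)]
  simp only [expNeg_mul_natCast]
  rw [lintegral_pow_poissonMeasure _ (expNeg_le_one a), ENNReal.coe_toNNReal hΛ]

theorem lintegral_expNeg_sum_pointCount (hv : IsPoissonPointProcess v Λ μ) (I : Finset ι)
    {A : ι → Set E} (hA : ∀ i, MeasurableSet (A i)) (hdisj : (I : Set ι).PairwiseDisjoint A)
    (hΛ : ∀ i ∈ I, Λ (A i) ≠ ∞) (a : ι → ℝ≥0∞) :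
    ∫⁻ ω, expNeg (∑ i ∈ I, a i * pointCount v (A i) ω) ∂μ =
      expNeg (∑ i ∈ I, Λ (A i) * (1 - expNeg (a i))) := by
  have hreindex : ∀ f : ι → ℝ≥0∞, ∑ i ∈ I, f i = ∑ k, f (I.equivFin.symm k) := fun f => by
    rw [← Finset.sum_coe_sort, ← I.equivFin.symm.sum_comp]
  have hind : iIndepFun (fun k ω => expNeg
      (a (I.equivFin.symm k) * pointCount v (A (I.equivFin.symm k)) ω)) μ :=
    (hv.indep_count _ (fun k => A (I.equivFin.symm k)) (fun _ => hA _) fun k k' hk =>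
      hdisj (Subtype.coe_prop _) (Subtype.coe_prop _)
        fun h => hk (I.equivFin.symm.injective (Subtype.ext h))).comp
      (fun k t => expNeg (a (I.equivFin.symm k) * t)) fun k => by fun_prop
  simp only [hreindex, expNeg_sum]
  rw [lintegral_prod_eq_prod_lintegral_of_indepFun Finset.univ _ hind fun k => by
    have := measurable_pointCount hv.measurable (hA (I.equivFin.symm k))
    fun_prop]
  exact Finset.prod_congr rfl fun k _ =>
    hv.lintegral_expNeg_pointCount (hA _) (hΛ _ (Subtype.coe_prop _)) _

theorem lintegral_expNeg_tsum_simpleFunc (hv : IsPoissonPointProcess v Λ μ)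
    (s : SimpleFunc E ℝ≥0∞) (hs : s.FinMeasSupp Λ) :
    ∫⁻ ω, expNeg (∑' j, s (v j ω)) ∂μ = expNeg (∫⁻ z, (1 - expNeg (s z)) ∂Λ) := by
  have hleft : ∀ ω, ∑' j, s (v j ω) =
      ∑ y ∈ s.range.erase 0, y * pointCount v (s ⁻¹' {y}) ω := fun ω => by
    rw [tsum_simpleFunc_eq_sum_pointCount, Finset.sum_erase _ (zero_mul _)]
  have hright : ∫⁻ z, (1 - expNeg (s z)) ∂Λ =
      ∑ y ∈ s.range.erase 0, Λ (s ⁻¹' {y}) * (1 - expNeg y) := by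
    rw [Finset.sum_erase _ (by simp)]
    simp only [mul_comm (Λ _)]
    rw [← SimpleFunc.map_lintegral (fun t => 1 - expNeg t) s, ← SimpleFunc.lintegral_eq_lintegral]
    rfl
  simp only [hleft]
  rw [hright]
  exact hv.lintegral_expNeg_sum_pointCount _ s.measurableSet_fiber
    (fun y _ y' _ h => (disjoint_singleton.2 h).preimage s)
    (fun y hy => (SimpleFunc.finMeasSupp_iff.1 hs y (Finset.ne_of_mem_erase hy)).ne) id

end IsPoissonPointProcess

/-- Simple functions of finite-measure support that increase to the measurable function `f`. -/
noncomputable def finMeasApprox (Λ : Measure E) [SigmaFinite Λ] (f : E → ℝ≥0∞) (n : ℕ) :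
    SimpleFunc E ℝ≥0∞ :=
  (SimpleFunc.eapprox f n).restrict (spanningSets Λ n)

section FinMeasApprox

variable [SigmaFinite Λ] {f : E → ℝ≥0∞}

theorem coe_finMeasApprox (n : ℕ) :
    ⇑(finMeasApprox Λ f n) = (spanningSets Λ n).indicator (SimpleFunc.eapprox f n) :=
  SimpleFunc.coe_restrict _ (measurableSet_spanningSets Λ n)

theorem finMeasSupp_finMeasApprox (n : ℕ) : (finMeasApprox Λ f n).FinMeasSupp Λ := by
  refine SimpleFunc.finMeasSupp_iff_support.2 ((measure_mono ?_).trans_lt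
    (measure_spanningSets_lt_top Λ n))
  rw [coe_finMeasApprox]
  exact support_indicator_subset

theorem monotone_finMeasApprox (z : E) : Monotone fun n => finMeasApprox Λ f n z :=
  fun n m hnm => by
    simp only [coe_finMeasApprox]
    exact (indicator_le_indicator' fun _ => SimpleFunc.monotone_eapprox f hnm z).trans
      (indicator_le_indicator_of_subset (monotone_spanningSets Λ hnm) (fun _ => zero_le) z)

theorem tendsto_finMeasApprox (hf : Measurable f) (z : E) :
    Tendsto (fun n => finMeasApprox Λ f n z) atTop (nhds (f z)) := by
  refine (SimpleFunc.tendsto_eapprox hf z).congr' ?_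
  filter_upwards [eventually_ge_atTop (spanningSetsIndex Λ z)] with n hn
  rw [coe_finMeasApprox, indicator_of_mem
    (monotone_spanningSets Λ hn (mem_spanningSetsIndex Λ z))]

end FinMeasApprox

theorem tendsto_tsum_of_monotone {F : ℕ → ℕ → ℝ≥0∞} {f : ℕ → ℝ≥0∞}
    (hmono : ∀ j, Monotone fun n => F n j)
    (hlim : ∀ j, Tendsto (fun n => F n j) atTop (nhds (f j))) :
    Tendsto (fun n => ∑' j, F n j) atTop (nhds (∑' j, f j)) := by
  simpa only [lintegral_count] using lintegral_tendsto_of_tendsto_of_monotone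
    (μ := Measure.count) (fun n => (measurable_of_countable (F n)).aemeasurable)
    (.of_forall hmono) (.of_forall hlim)

/- Both sides are continuous along the monotone approximation of `f` by `finMeasApprox`. -/
theorem IsPoissonPointProcess.lintegral_expNeg_tsum [SigmaFinite Λ] [IsFiniteMeasure μ]
    (hv : IsPoissonPointProcess v Λ μ) {f : E → ℝ≥0∞} (hf : Measurable f) :
    ∫⁻ ω, expNeg (∑' j, f (v j ω)) ∂μ = expNeg (∫⁻ z, (1 - expNeg (f z)) ∂Λ) := by
  have hprocess : Tendsto (fun n => ∫⁻ ω, expNeg (∑' j, finMeasApprox Λ f n (v j ω)) ∂μ) atTop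
      (nhds (∫⁻ ω, expNeg (∑' j, f (v j ω)) ∂μ)) :=
    tendsto_lintegral_expNeg
      (fun n => Measurable.tsum fun j => (SimpleFunc.measurable _).comp (hv.measurable j))
      fun ω => tendsto_tsum_of_monotone (fun j => monotone_finMeasApprox (v j ω))
        fun j => tendsto_finMeasApprox hf (v j ω)
  have hintensity : Tendsto (fun n => ∫⁻ z, (1 - expNeg (finMeasApprox Λ f n z)) ∂Λ) atTop
      (nhds (∫⁻ z, (1 - expNeg (f z)) ∂Λ)) := by
    refine lintegral_tendsto_of_tendsto_of_monotone
      (fun n => Measurable.aemeasurable (by fun_prop))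
      (.of_forall fun z n m hnm => ?_) (.of_forall fun z => ?_)
    · exact tsub_le_tsub_left (antitone_expNeg (monotone_finMeasApprox z hnm)) 1
    · exact ENNReal.Tendsto.sub tendsto_const_nhds
        ((continuous_expNeg.tendsto _).comp (tendsto_finMeasApprox hf z))
        (Or.inl ENNReal.one_ne_top)
  refine tendsto_nhds_unique hprocess
    (((continuous_expNeg.tendsto _).comp hintensity).congr fun n => ?_)
  exact (hv.lintegral_expNeg_tsum_simpleFunc _ (finMeasSupp_finMeasApprox n)).symm

end PoissonProcess

section ProductKernel

variable {ι X : Type*} [Fintype ι] {Y : ι → Type*} [MeasurableSpace X]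
  [∀ i, MeasurableSpace (Y i)]

/-- The product of finitely many Markov kernels with the same source: given `x`, the coordinates
are independent and the `i`-th one has the distribution `κ i x`. -/
noncomputable def piKernel (κ : ∀ i, Kernel X (Y i)) [∀ i, IsMarkovKernel (κ i)] :
    Kernel X (∀ i, Y i) where
  toFun x := Measure.pi fun i => κ i x
  measurable' := by
    refine Measurable.measure_of_isPiSystem_of_isProbabilityMeasure generateFrom_pi.symm
      isPiSystem_pi ?_
    rintro _ ⟨B, hB, rfl⟩
    simp only [Measure.pi_pi]
    exact Finset.measurable_prod _ fun i _ => (κ i).measurable_coe (hB i (mem_univ i))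

variable (κ : ∀ i, Kernel X (Y i)) [∀ i, IsMarkovKernel (κ i)]

theorem piKernel_apply (x : X) : piKernel κ x = Measure.pi fun i => κ i x := rfl

instance : IsMarkovKernel (piKernel κ) :=
  ⟨fun x => by rw [piKernel_apply]; infer_instance⟩

theorem lintegral_prod_piKernel {f : ∀ i, Y i → ℝ≥0∞} (hf : ∀ i, Measurable (f i)) (x : X) :
    ∫⁻ y, ∏ i, f i (y i) ∂piKernel κ x = ∏ i, ∫⁻ t, f i t ∂κ i x := by
  rw [piKernel_apply, lintegral_prod_eq_prod_lintegral_of_indepFun Finset.univ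
    (fun i (y : ∀ i, Y i) => f i (y i)) (iIndepFun_pi fun i => (hf i).aemeasurable)
    fun i => (hf i).comp (measurable_pi_apply i)]
  exact Finset.prod_congr rfl fun i _ =>
    (measurePreserving_eval (fun i => κ i x) i).lintegral_comp (hf i)

end ProductKernel

section Marking

variable {Ω E M : Type*} [MeasurableSpace Ω] [MeasurableSpace E] [MeasurableSpace M]
  {v : ℕ → Ω → E} {θ : ℕ → Ω → M} {μ : Measure Ω}

theorem isIndependentMarking_of_indepFun {ρ : Measure M} (hθ : ∀ j, Measurable (θ j))
    (hlaw : ∀ j, HasLaw (θ j) ρ μ) (hindep : iIndepFun θ μ)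
    (hind : IndepFun (fun ω j => θ j ω) (fun ω j => v j ω) μ) :
    IsIndependentMarking v θ (fun _ => ρ) μ where
  measurable := hθ
  cond_law J C B hC hB := by
    have hbox : MeasurableSet ((J : Set ℕ).pi B) :=
      MeasurableSet.pi J.countable_toSet fun j _ => hB j
    have hmarks : μ ((fun ω j => θ j ω) ⁻¹' (J : Set ℕ).pi B) = ∏ j ∈ J, ρ (B j) := by
      have hset : (fun ω j => θ j ω) ⁻¹' (J : Set ℕ).pi B = ⋂ j ∈ J, θ j ⁻¹' B j := by
        ext ω
        simp
      rw [hset, hindep.measure_inter_preimage_eq_mul J fun j _ => hB j]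
      exact Finset.prod_congr rfl fun j _ => by
        rw [← (hlaw j).map_eq, Measure.map_apply (hθ j) (hB j)]
    calc μ {ω | (fun j => v j ω) ∈ C ∧ ∀ j ∈ J, θ j ω ∈ B j}
        = μ ((fun ω j => θ j ω) ⁻¹' (J : Set ℕ).pi B ∩ (fun ω j => v j ω) ⁻¹' C) :=
          congrArg μ (ext fun _ => and_comm)
      _ = (∏ j ∈ J, ρ (B j)) * μ ((fun ω j => v j ω) ⁻¹' C) := by
          rw [hind.measure_inter_preimage_eq_mul _ _ hbox hC, hmarks]
      _ = ∫⁻ _ in {ω | (fun j => v j ω) ∈ C}, ∏ j ∈ J, ρ (B j) ∂μ := (setLIntegral_const _ _).symm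

namespace IsIndependentMarking

variable {κ : Kernel E M} [IsMarkovKernel κ] [IsFiniteMeasure μ]

theorem map_prodMk_prod_univ_pi (h : IsIndependentMarking v θ κ μ) (hv : ∀ j, Measurable (v j))
    (J : Finset ℕ) {C : Set (ℕ → E)} {B : J → Set M} (hC : MeasurableSet C)
    (hB : ∀ j, MeasurableSet (B j)) :
    μ.map (fun ω => ((fun j => v j ω : ℕ → E), (fun j => θ j ω : J → M))) (C ×ˢ univ.pi B) =
      ((μ.map fun ω j => v j ω) ⊗ₘ piKernel fun j : J =>
        κ.comap (fun x : ℕ → E => x j) (measurable_pi_apply _)) (C ×ˢ univ.pi B) := by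
  have hvm : Measurable fun ω j => v j ω := measurable_pi_lambda _ hv
  have hθm : Measurable fun ω (j : J) => θ j ω := measurable_pi_lambda _ fun j => h.measurable j
  have hBpi : MeasurableSet (univ.pi B) := MeasurableSet.univ_pi hB
  set B' : ℕ → Set M := fun j => if hj : j ∈ J then B ⟨j, hj⟩ else univ with hB'
  have hB'_coe : ∀ j : J, B' j = B j := fun j => by simp [hB']
  have hB'_meas : ∀ j, MeasurableSet (B' j) := fun j => by
    by_cases hj : j ∈ J
    · simpa only [hB', hj, dite_true] using hB ⟨j, hj⟩
    · simp only [hB', hj, dite_false, MeasurableSet.univ]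
  have hset : (fun ω => ((fun j => v j ω : ℕ → E), (fun j => θ j ω : J → M))) ⁻¹'
      C ×ˢ univ.pi B = {ω | (fun j => v j ω) ∈ C ∧ ∀ j ∈ J, θ j ω ∈ B' j} := by
    ext ω
    simp only [mem_preimage, mem_prod, mem_univ_pi, ← hB'_coe, Subtype.forall, mem_ofPred_eq]
  rw [Measure.map_apply (hvm.prodMk hθm) (hC.prod hBpi), hset,
    h.cond_law J C B' hC hB'_meas, Measure.compProd_apply_prod hC hBpi,
    setLIntegral_map hC (Kernel.measurable_coe _ hBpi) hvm]
  refine lintegral_congr fun ω => ?_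
  rw [piKernel_apply, Measure.pi_pi, ← Finset.prod_coe_sort]
  simp only [hB'_coe, Kernel.comap_apply]

theorem map_prodMk_eq_compProd (h : IsIndependentMarking v θ κ μ) (hv : ∀ j, Measurable (v j))
    (J : Finset ℕ) :
    μ.map (fun ω => ((fun j => v j ω : ℕ → E), (fun j => θ j ω : J → M))) =
      (μ.map fun ω j => v j ω) ⊗ₘ
        piKernel fun j : J => κ.comap (fun x : ℕ → E => x j) (measurable_pi_apply _) := by
  refine ext_of_generate_finite _ (generateFrom_eq_prod
    MeasurableSpace.generateFrom_measurableSet generateFrom_pi isCountablySpanning_measurableSet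
    (.pi fun _ => isCountablySpanning_measurableSet)).symm
    (MeasurableSpace.isPiSystem_measurableSet.prod isPiSystem_pi) ?_ ?_
  · rintro _ ⟨C, hC, _, ⟨B, hB, rfl⟩, rfl⟩
    exact h.map_prodMk_prod_univ_pi hv J hC fun j => hB j (mem_univ j)
  · simpa only [pi_univ, univ_prod_univ] using
      h.map_prodMk_prod_univ_pi hv J (B := fun _ => univ) MeasurableSet.univ
        fun _ => MeasurableSet.univ

theorem lintegral_prod (h : IsIndependentMarking v θ κ μ) (hv : ∀ j, Measurable (v j))
    {g : E × M → ℝ≥0∞} (hg : Measurable g) (J : Finset ℕ) :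
    ∫⁻ ω, ∏ j ∈ J, g (v j ω, θ j ω) ∂μ =
      ∫⁻ ω, ∏ j ∈ J, ∫⁻ t, g (v j ω, t) ∂κ (v j ω) ∂μ := by
  have hvm : Measurable fun ω j => v j ω := measurable_pi_lambda _ hv
  have hθm : Measurable fun ω (j : J) => θ j ω := measurable_pi_lambda _ fun j => h.measurable j
  have hG : Measurable fun p : (ℕ → E) × (J → M) => ∏ j : J, g (p.1 j, p.2 j) :=
    Finset.measurable_prod _ fun j _ => by fun_prop
  have hmean : Measurable fun z => ∫⁻ t, g (z, t) ∂κ z := hg.lintegral_kernel_prod_right'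
  have hmeans : Measurable fun x : ℕ → E => ∏ j : J, ∫⁻ t, g (x j, t) ∂κ (x j) :=
    Finset.measurable_prod _ fun j _ => hmean.comp (measurable_pi_apply (j : ℕ))
  calc ∫⁻ ω, ∏ j ∈ J, g (v j ω, θ j ω) ∂μ
      = ∫⁻ p, ∏ j : J, g (p.1 j, p.2 j)
          ∂μ.map fun ω => ((fun j => v j ω : ℕ → E), (fun j => θ j ω : J → M)) := by
        rw [lintegral_map hG (hvm.prodMk hθm)]
        exact lintegral_congr fun ω => (Finset.prod_coe_sort J _).symm
    _ = ∫⁻ x, ∏ j : J, ∫⁻ t, g (x j, t) ∂κ (x j) ∂μ.map fun ω j => v j ω := by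
        rw [h.map_prodMk_eq_compProd hv, Measure.lintegral_compProd hG]
        exact lintegral_congr fun x => lintegral_prod_piKernel _
          (f := fun (j : J) t => g (x j, t)) (fun j => by fun_prop) x
    _ = ∫⁻ ω, ∏ j ∈ J, ∫⁻ t, g (v j ω, t) ∂κ (v j ω) ∂μ := by
        rw [lintegral_map hmeans hvm]
        exact lintegral_congr fun ω => Finset.prod_coe_sort J
          fun j => ∫⁻ t, g (v j ω, t) ∂κ (v j ω)

/- Finitely many points are treated by `lintegral_prod`; the passage to the limit needs the
conditional expectations in the form `expNeg (negLog _)`. -/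
theorem lintegral_expNeg_tsum (h : IsIndependentMarking v θ κ μ) (hv : ∀ j, Measurable (v j))
    {f : E × M → ℝ≥0∞} (hf : Measurable f) :
    ∫⁻ ω, expNeg (∑' j, f (v j ω, θ j ω)) ∂μ =
      ∫⁻ ω, expNeg (∑' j, negLog (∫⁻ t, expNeg (f (v j ω, t)) ∂κ (v j ω))) ∂μ := by
  have hmean : Measurable fun z => ∫⁻ t, expNeg (f (z, t)) ∂κ z :=
    Measurable.lintegral_kernel_prod_right' (f := fun p => expNeg (f p)) (by fun_prop)
  have hmean_le : ∀ z, ∫⁻ t, expNeg (f (z, t)) ∂κ z ≤ 1 := fun z =>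
    (lintegral_mono fun t => expNeg_le_one _).trans (by simp)
  have hprod : ∀ N, ∫⁻ ω, ∏ j ∈ Finset.range N, expNeg (f (v j ω, θ j ω)) ∂μ =
      ∫⁻ ω, ∏ j ∈ Finset.range N, expNeg (negLog (∫⁻ t, expNeg (f (v j ω, t)) ∂κ (v j ω))) ∂μ := by
    intro N
    simp only [expNeg_negLog (hmean_le _)]
    exact h.lintegral_prod hv (g := fun p => expNeg (f p)) (by fun_prop) _
  refine tendsto_nhds_unique
    (tendsto_lintegral_prod_expNeg fun j => hf.comp ((hv j).prodMk (h.measurable j))) ?_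
  simp only [hprod]
  exact tendsto_lintegral_prod_expNeg fun j => measurable_negLog.comp (hmean.comp (hv j))

end IsIndependentMarking

end Marking

section ExponentialFading

theorem lintegral_expNeg_expMeasure {r c : ℝ} (hr : 0 < r) (hc : 0 ≤ c) :
    ∫⁻ x, expNeg (ENNReal.ofReal (c * x)) ∂expMeasure r = ENNReal.ofReal (r / (r + c)) := by
  have hm : Measurable (exponentialPDF r) := (measurable_exponentialPDFReal r).ennreal_ofReal
  have htilt : ∀ x, exponentialPDF r x * expNeg (ENNReal.ofReal (c * x)) =
      ENNReal.ofReal (r / (r + c)) * exponentialPDF (r + c) x := fun x => by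
    rcases lt_or_ge x 0 with hx | hx
    · simp [exponentialPDF_of_neg hx]
    · rw [exponentialPDF_of_nonneg hx, exponentialPDF_of_nonneg hx,
        expNeg_ofReal (mul_nonneg hc hx), ← ENNReal.ofReal_mul (by positivity),
        ← ENNReal.ofReal_mul (by positivity), mul_assoc, ← exp_add, ← mul_assoc,
        div_mul_cancel₀ _ (by positivity)]
      ring_nf
  rw [show expMeasure r = volume.withDensity (exponentialPDF r) from rfl,
    lintegral_withDensity_eq_lintegral_mul _ hm (by fun_prop)]
  simp only [Pi.mul_apply, htilt]
  rw [lintegral_const_mul' _ _ ENNReal.ofReal_ne_top,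
    lintegral_exponentialPDF_eq_one (by positivity), mul_one]

theorem expMeasure_setOf_lt_ofReal (t : ℝ≥0∞) :
    expMeasure 1 {x | t < ENNReal.ofReal x} = expNeg t := by
  have := isProbabilityMeasure_expMeasure one_pos
  induction t with
  | top => simp
  | coe t =>
    have hset : {x | (t : ℝ≥0∞) < ENNReal.ofReal x} = (Iic (t : ℝ))ᶜ := by
      ext x
      simp [ENNReal.lt_ofReal_iff_toReal_lt]
    rw [hset, ← ofReal_measureReal, probReal_compl_eq_one_sub measurableSet_Iic, ← cdf_eq_real,
      cdf_expMeasure_eq one_pos, if_pos t.coe_nonneg, one_mul, sub_sub_cancel,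
      ← ENNReal.ofReal_coe_nnreal, expNeg_ofReal t.coe_nonneg]

variable {Ω X : Type*} [MeasurableSpace Ω] [MeasurableSpace X] {μ : Measure Ω}

theorem measure_lt_ofReal_of_hasLaw_exp [IsFiniteMeasure μ] {h₀ : Ω → ℝ} {Y : Ω → ℝ≥0∞}
    (hm₀ : Measurable h₀) (hY : Measurable Y) (hlaw : HasLaw h₀ (expMeasure 1) μ)
    (hind : IndepFun h₀ Y μ) :
    μ {ω | Y ω < ENNReal.ofReal (h₀ ω)} = ∫⁻ ω, expNeg (Y ω) ∂μ := by
  have hS : MeasurableSet {p : ℝ × ℝ≥0∞ | p.2 < ENNReal.ofReal p.1} :=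
    measurableSet_lt (by fun_prop) (by fun_prop)
  have hmap : μ.map (fun ω => (h₀ ω, Y ω)) = (expMeasure 1).prod (μ.map Y) := by
    rw [(indepFun_iff_map_prod_eq_prod_map_map hm₀.aemeasurable hY.aemeasurable).1 hind,
      hlaw.map_eq]
  have := isProbabilityMeasure_expMeasure one_pos
  calc μ {ω | Y ω < ENNReal.ofReal (h₀ ω)}
      = μ.map (fun ω => (h₀ ω, Y ω)) {p | p.2 < ENNReal.ofReal p.1} :=
        (Measure.map_apply (hm₀.prodMk hY) hS).symm
    _ = ∫⁻ y, expMeasure 1 {x | y < ENNReal.ofReal x} ∂μ.map Y := by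
        rw [hmap, Measure.prod_apply_symm hS]
        rfl
    _ = ∫⁻ ω, expNeg (Y ω) ∂μ := by
        simp only [expMeasure_setOf_lt_ofReal]
        exact lintegral_map (by fun_prop) hY

theorem IsIndependentMarking.lintegral_expNeg_tsum_exp_mul [IsFiniteMeasure μ] {x : ℕ → Ω → X}
    {h : ℕ → Ω → ℝ} (hh : IsIndependentMarking x h (fun _ => expMeasure 1) μ)
    (hx : ∀ j, Measurable (x j)) {q : X → ℝ} (hq : Measurable q) (hq₀ : ∀ p, 0 ≤ q p) :
    ∫⁻ ω, expNeg (∑' j, ENNReal.ofReal (q (x j ω) * h j ω)) ∂μ =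
      ∫⁻ ω, expNeg (∑' j, negLog (ENNReal.ofReal (1 / (1 + q (x j ω))))) ∂μ := by
  have := isProbabilityMeasure_expMeasure one_pos
  simp only [← lintegral_expNeg_expMeasure one_pos (hq₀ _)]
  exact IsIndependentMarking.lintegral_expNeg_tsum (κ := Kernel.const X (expMeasure 1)) hh hx
    (f := fun p => ENNReal.ofReal (q p.1 * p.2)) (by fun_prop)

end ExponentialFading

section MarkedPoisson

variable {Ω E M : Type*} [MeasurableSpace Ω] [MeasurableSpace E] [MeasurableSpace M]
  {μ : Measure Ω} {v : ℕ → Ω → E} {θ : ℕ → Ω → M} {h : ℕ → Ω → ℝ} {Λ : Measure E}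
  {κ : Kernel E M}

theorem one_sub_lintegral_one_div_one_add [IsMarkovKernel κ] {q : E × M → ℝ} (hq : Measurable q)
    (hq₀ : ∀ p, 0 ≤ q p) (z : E) :
    1 - ∫⁻ t, ENNReal.ofReal (1 / (1 + q (z, t))) ∂κ z =
      ∫⁻ t, ENNReal.ofReal (q (z, t) / (1 + q (z, t))) ∂κ z := by
  have hle : ∀ t, ENNReal.ofReal (1 / (1 + q (z, t))) ≤ 1 := fun t =>
    ENNReal.ofReal_le_one.2 (div_le_one_of_le₀ (by linarith [hq₀ (z, t)])
      (by linarith [hq₀ (z, t)]))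
  have hsub : ∀ t, ENNReal.ofReal (q (z, t) / (1 + q (z, t))) =
      1 - ENNReal.ofReal (1 / (1 + q (z, t))) := fun t => by
    have := hq₀ (z, t)
    rw [← ENNReal.ofReal_one, ← ENNReal.ofReal_sub _ (by positivity),
      one_sub_div (by positivity), add_sub_cancel_left]
  simp only [hsub]
  rw [lintegral_sub (by fun_prop) (ne_top_of_le_ne_top ENNReal.one_ne_top
    ((lintegral_mono hle).trans (by simp))) (.of_forall hle)]
  simp

/- Both layers of marks are integrated out point by point, which turns the sum into a functional of
the Poisson process alone. -/
theorem IsPoissonPointProcess.lintegral_expNeg_tsum_exp_mul [SigmaFinite Λ] [IsFiniteMeasure μ]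
    [IsMarkovKernel κ] (hv : IsPoissonPointProcess v Λ μ) (hθ : IsIndependentMarking v θ κ μ)
    (hh : IsIndependentMarking (fun j ω => (v j ω, θ j ω)) h (fun _ => expMeasure 1) μ)
    {q : E × M → ℝ} (hq : Measurable q) (hq₀ : ∀ p, 0 ≤ q p) :
    ∫⁻ ω, expNeg (∑' j, ENNReal.ofReal (q (v j ω, θ j ω) * h j ω)) ∂μ =
      expNeg (∫⁻ z, ∫⁻ t, ENNReal.ofReal (q (z, t) / (1 + q (z, t))) ∂κ z ∂Λ) := by
  have hr : Measurable fun p => ENNReal.ofReal (1 / (1 + q p)) := by fun_prop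
  have hr_le : ∀ p, ENNReal.ofReal (1 / (1 + q p)) ≤ 1 := fun p =>
    ENNReal.ofReal_le_one.2 (div_le_one_of_le₀ (by linarith [hq₀ p]) (by linarith [hq₀ p]))
  have hmean_le : ∀ z, ∫⁻ t, ENNReal.ofReal (1 / (1 + q (z, t))) ∂κ z ≤ 1 := fun z =>
    (lintegral_mono fun t => hr_le _).trans (by simp)
  rw [hh.lintegral_expNeg_tsum_exp_mul (fun j => (hv.measurable j).prodMk (hθ.measurable j)) hq
      hq₀,
    hθ.lintegral_expNeg_tsum hv.measurable
      (f := fun p => negLog (ENNReal.ofReal (1 / (1 + q p)))) (measurable_negLog.comp hr)]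
  simp only [expNeg_negLog (hr_le _)]
  rw [hv.lintegral_expNeg_tsum
    (f := fun z => negLog (∫⁻ t, ENNReal.ofReal (1 / (1 + q (z, t))) ∂κ z))
    (measurable_negLog.comp hr.lintegral_kernel_prod_right')]
  simp only [expNeg_negLog (hmean_le _), one_sub_lintegral_one_div_one_add hq hq₀]

end MarkedPoisson

section Interference

variable {G : ℝ → ℝ} {T η a b φ₀ : ℝ} {n : ℕ}

theorem abs_gain_sub_one_le (b : ℝ) (n : ℕ) (t : ℝ) : |gain b n t - 1| ≤ |b| := by
  rw [gain, add_sub_cancel_left, abs_mul]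
  exact mul_le_of_le_one_right (abs_nonneg b) (abs_cos_le_one _)

theorem gain_nonneg (hb : |b| ≤ 1) (n : ℕ) (t : ℝ) : 0 ≤ gain b n t := by
  linarith [neg_le_of_abs_le (abs_gain_sub_one_le b n t)]

theorem gain_zero (b : ℝ) (n : ℕ) : gain b n 0 = 1 + b := by simp [gain]

@[fun_prop]
theorem continuous_gain (b : ℝ) (n : ℕ) : Continuous (gain b n) := by
  unfold gain
  fun_prop

theorem periodic_gain (b : ℝ) (n : ℕ) : Function.Periodic (gain b n) (2 * π) := fun t => by
  rw [gain, gain, mul_add, cos_add_nat_mul_two_pi]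

/-- The mean received power from a device with location and orientation `p`, in units of `T⁻¹` and
for the antenna gain `G`; it vanishes for devices closer than `a`. -/
noncomputable def relPower (T η a : ℝ) (G : ℝ → ℝ) (φ₀ : ℝ) (p : ℂ × ℝ) : ℝ :=
  {z : ℂ | a ≤ ‖z‖}.indicator (fun z => T * G (z.arg - φ₀) * G p.2 * ‖z‖ ^ (-η)) p.1

theorem relPower_nonneg (hT : 0 ≤ T) (hG₀ : ∀ t, 0 ≤ G t) (p : ℂ × ℝ) :
    0 ≤ relPower T η a G φ₀ p := by
  refine indicator_nonneg (fun z _ => ?_) p.1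
  have := hG₀ (z.arg - φ₀)
  have := hG₀ p.2
  positivity

theorem measurable_relPower (hG : Measurable G) : Measurable (relPower T η a G φ₀) := by
  have hset : MeasurableSet {p : ℂ × ℝ | a ≤ ‖p.1‖} := measurableSet_le (by fun_prop) (by fun_prop)
  have := Complex.measurable_arg
  exact Measurable.indicator (f := fun p : ℂ × ℝ =>
    T * G (p.1.arg - φ₀) * G p.2 * ‖p.1‖ ^ (-η)) (by fun_prop) hset

variable {Ω : Type*} {v : ℕ → Ω → ℂ} {θ h : ℕ → Ω → ℝ} {h₀ : Ω → ℝ} {P Ξ σ r₀ R : ℝ}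

theorem ofReal_mul_interference {s : ℝ} (hs : 0 ≤ s) (ω : Ω) :
    ENNReal.ofReal s * interference P η R b n φ₀ v θ h ω =
      ∑' j, ENNReal.ofReal
        (relPower (s * P) η (√3 * R / 2) (gain b n) φ₀ (v j ω, θ j ω) * h j ω) := by
  rw [interference, ← ENNReal.tsum_mul_left]
  refine tsum_congr fun j => ?_
  by_cases hz : v j ω ∈ {z : ℂ | √3 * R / 2 ≤ ‖z‖}
  · rw [relPower, indicator_of_mem hz, indicator_of_mem hz, ← ENNReal.ofReal_mul hs]
    congr 1
    ring
  · rw [relPower, indicator_of_notMem hz, indicator_of_notMem hz]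
    simp

theorem ofReal_lt_sinr_iff (hΞ : 0 < Ξ) (hP : 0 < P) (hg : 0 < gain b n 0) (hr₀ : 0 < r₀) (ω : Ω) :
    ENNReal.ofReal Ξ < sinr P σ η R b n φ₀ r₀ v θ h h₀ ω ↔
      ENNReal.ofReal (Ξ * r₀ ^ η * σ ^ 2 / (gain b n 0 * gain b n 0 * P)) +
        ENNReal.ofReal (Ξ * r₀ ^ η / (gain b n 0 * gain b n 0 * P)) *
          interference P η R b n φ₀ v θ h ω < ENNReal.ofReal (h₀ ω) := by
  set g := gain b n 0
  set s := Ξ * r₀ ^ η / (g * g * P) with hs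
  have hs₀ : 0 ≤ s := by positivity
  have hk : 0 < P * g * g * r₀ ^ (-η) := by positivity
  have hΞ_eq : Ξ = P * g * g * r₀ ^ (-η) * s := by
    rw [hs, rpow_neg hr₀.le]
    field_simp
  have hnoise : Ξ * r₀ ^ η * σ ^ 2 / (g * g * P) = s * σ ^ 2 := by
    rw [hs]
    ring
  rw [sinr, ENNReal.lt_div_iff_mul_lt (.inr ENNReal.ofReal_ne_top) (.inr (by simpa using hΞ)),
    hnoise, ENNReal.ofReal_mul hs₀, ← mul_add, hΞ_eq, ENNReal.ofReal_mul hk.le,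
    show P * h₀ ω * g * g * r₀ ^ (-η) = P * g * g * r₀ ^ (-η) * h₀ ω by ring,
    ENNReal.ofReal_mul hk.le, mul_assoc]
  exact ENNReal.mul_lt_mul_iff_right (by simpa using hk) ENNReal.ofReal_ne_top

theorem measurable_interference [MeasurableSpace Ω] (hv : ∀ j, Measurable (v j))
    (hθ : ∀ j, Measurable (θ j)) (hh : ∀ j, Measurable (h j)) :
    Measurable (interference P η R b n φ₀ v θ h) := by
  have hsum : interference P η R b n φ₀ v θ h = fun ω => ∑' j, ENNReal.ofReal
      (relPower P η (√3 * R / 2) (gain b n) φ₀ (v j ω, θ j ω) * h j ω) := by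
    ext ω
    simpa using ofReal_mul_interference zero_le_one ω
  have hrel := measurable_relPower (T := P) (η := η) (a := √3 * R / 2) (φ₀ := φ₀)
    (continuous_gain b n).measurable
  rw [hsum]
  exact Measurable.tsum fun j =>
    ((hrel.comp ((hv j).prodMk (hθ j))).mul (hh j)).ennreal_ofReal

end Interference

section Orientation

theorem isProbabilityMeasure_cond_Icc {α β : ℝ} (h : α < β) :
    IsProbabilityMeasure (cond (volume : Measure ℝ) (Icc α β)) :=
  cond_isProbabilityMeasure_of_finite (by simpa using h) (by simp)

open Classical in
/-- `orientationLaw` as a kernel. -/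
noncomputable def orientationKernel (R : ℝ) : Kernel ℂ ℝ :=
  Kernel.piecewise (measurableSet_le measurable_norm measurable_const : MeasurableSet
      {z : ℂ | ‖z‖ ≤ √3 * R})
    (Kernel.const ℂ (cond volume (Icc (π / 2) (3 * π / 2))))
    (Kernel.const ℂ (cond volume (Icc 0 (2 * π))))

theorem coe_orientationKernel (R : ℝ) : ⇑(orientationKernel R) = orientationLaw R := by
  ext1 z
  simp [orientationKernel, orientationLaw, Kernel.piecewise_apply]

instance (R : ℝ) : IsMarkovKernel (orientationKernel R) where
  isProbabilityMeasure z := by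
    rw [coe_orientationKernel, orientationLaw]
    split_ifs <;> exact isProbabilityMeasure_cond_Icc (by linarith [pi_pos])

theorem orientationLaw_of_norm_le {R : ℝ} {z : ℂ} (hz : ‖z‖ ≤ √3 * R) :
    orientationLaw R z = cond volume (Icc (π / 2) (3 * π / 2)) := if_pos hz

theorem orientationLaw_of_lt_norm {R : ℝ} {z : ℂ} (hz : √3 * R < ‖z‖) :
    orientationLaw R z = cond volume (Icc 0 (2 * π)) := if_neg hz.not_ge

end Orientation

section SuccessProbability

variable {Ω : Type*} [MeasurableSpace Ω] {μ : Measure Ω} {lam R : ℝ}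
  {v : ℕ → Ω → ℂ} {θ h : ℕ → Ω → ℝ} {h₀ : Ω → ℝ} {P η b σ r₀ φ₀ : ℝ} {n : ℕ}

theorem IsPoissonModel.isIndependentMarking_fading (hmodel : IsPoissonModel μ lam R v θ h h₀) :
    IsIndependentMarking (fun j ω => (v j ω, θ j ω)) h (fun _ => expMeasure 1) μ :=
  isIndependentMarking_of_indepFun hmodel.measurable_fading hmodel.law_fading hmodel.indep_fading
    (hmodel.indep_fading_devices.comp measurable_id
      (show Measurable fun p : (ℕ → ℂ) × (ℕ → ℝ) => fun j => (p.1 j, p.2 j) by fun_prop))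

theorem IsPoissonModel.lintegral_expNeg_interference [IsFiniteMeasure μ]
    (hmodel : IsPoissonModel μ lam R v θ h h₀) {s : ℝ} (hs : 0 ≤ s) (hP : 0 ≤ P) (hb : |b| ≤ 1) :
    ∫⁻ ω, expNeg (ENNReal.ofReal s * interference P η R b n φ₀ v θ h ω) ∂μ =
      expNeg (ENNReal.ofReal lam * ∫⁻ z, ∫⁻ t, ENNReal.ofReal
        (relPower (s * P) η (√3 * R / 2) (gain b n) φ₀ (z, t) /
          (1 + relPower (s * P) η (√3 * R / 2) (gain b n) φ₀ (z, t))) ∂orientationLaw R z) := by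
  have : IsLocallyFiniteMeasure (ENNReal.ofReal lam • (volume : Measure ℂ)) :=
    inferInstanceAs (IsLocallyFiniteMeasure (lam.toNNReal • (volume : Measure ℂ)))
  have hmark : IsIndependentMarking v θ (orientationKernel R) μ := by
    simpa only [coe_orientationKernel] using hmodel.orientations
  simp only [ofReal_mul_interference hs]
  rw [hmodel.locations.lintegral_expNeg_tsum_exp_mul hmark hmodel.isIndependentMarking_fading
      (measurable_relPower (continuous_gain b n).measurable)
      (relPower_nonneg (mul_nonneg hs hP) (gain_nonneg hb n)),
    coe_orientationKernel, lintegral_smul_measure, smul_eq_mul]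

theorem IsPoissonModel.indepFun_interference (hmodel : IsPoissonModel μ lam R v θ h h₀) :
    IndepFun h₀ (interference P η R b n φ₀ v θ h) μ :=
  hmodel.indep_fading₀.comp measurable_id (measurable_interference
    (v := fun j (p : (ℕ → ℝ) × (ℕ → ℂ) × (ℕ → ℝ)) => p.2.1 j) (θ := fun j p => p.2.2 j)
    (h := fun j p => p.1 j) (by fun_prop) (by fun_prop) (by fun_prop))

theorem IsPoissonModel.measure_lt_sinr [IsFiniteMeasure μ]
    (hmodel : IsPoissonModel μ lam R v θ h h₀) {Ξ : ℝ} (hΞ : 0 < Ξ) (hP : 0 < P)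
    (hg : 0 < gain b n 0) (hr₀ : 0 < r₀) :
    μ {ω | ENNReal.ofReal Ξ < sinr P σ η R b n φ₀ r₀ v θ h h₀ ω} =
      expNeg (ENNReal.ofReal (Ξ * r₀ ^ η * σ ^ 2 / (gain b n 0 * gain b n 0 * P))) *
        ∫⁻ ω, expNeg (ENNReal.ofReal (Ξ * r₀ ^ η / (gain b n 0 * gain b n 0 * P)) *
          interference P η R b n φ₀ v θ h ω) ∂μ := by
  have hI : Measurable (interference P η R b n φ₀ v θ h) := measurable_interference
    hmodel.locations.measurable hmodel.orientations.measurable hmodel.measurable_fading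
  have hind : ∀ u s : ℝ≥0∞,
      IndepFun h₀ (fun ω => u + s * interference P η R b n φ₀ v θ h ω) μ := fun u s =>
    hmodel.indepFun_interference.comp measurable_id
      (show Measurable fun y => u + s * y by fun_prop)
  simp only [ofReal_lt_sinr_iff hΞ hP hg hr₀]
  rw [measure_lt_ofReal_of_hasLaw_exp hmodel.measurable_fading₀ (by fun_prop) hmodel.law_fading₀
    (hind _ _)]
  simp only [expNeg_add]
  exact lintegral_const_mul _ (by fun_prop)

end SuccessProbability

section OrientationIntegrals

variable {k : ℝ → ℝ}

theorem setLIntegral_Icc_ofReal {α β : ℝ} (hαβ : α ≤ β) (hk : Continuous k)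
    (hk₀ : ∀ t, 0 ≤ k t) :
    ∫⁻ t in Icc α β, ENNReal.ofReal (k t) = ENNReal.ofReal (∫ t in α..β, k t) := by
  rw [intervalIntegral.integral_of_le hαβ, ← integral_Icc_eq_integral_Ioc]
  exact (ofReal_integral_eq_lintegral_ofReal hk.integrableOn_Icc (.of_forall hk₀)).symm

theorem lintegral_cond_Icc_ofReal {α β : ℝ} (hαβ : α < β) (hk : Continuous k)
    (hk₀ : ∀ t, 0 ≤ k t) :
    ∫⁻ t, ENNReal.ofReal (k t) ∂cond volume (Icc α β) =
      ENNReal.ofReal ((β - α)⁻¹ * ∫ t in α..β, k t) := by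
  rw [ProbabilityTheory.cond, lintegral_smul_measure, setLIntegral_Icc_ofReal hαβ.le hk hk₀,
    smul_eq_mul, Real.volume_Icc, ← ENNReal.ofReal_inv_of_pos (sub_pos.2 hαβ),
    ← ENNReal.ofReal_mul (inv_nonneg.2 (sub_pos.2 hαβ).le)]

theorem lintegral_Ici_orientationLaw {R a : ℝ} (ha₀ : 0 ≤ a) (ha : a ≤ √3 * R) {z : ℝ → ℂ}
    (hz : ∀ r, 0 ≤ r → ‖z r‖ = r) {k : ℝ → ℝ → ℝ≥0∞} (hk : Measurable (Function.uncurry k)) :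
    ∫⁻ r in Ici a, ∫⁻ t, k r t ∂orientationLaw R (z r) =
      (∫⁻ t, (∫⁻ r in Icc a (√3 * R), k r t) ∂cond volume (Icc (π / 2) (3 * π / 2))) +
        ∫⁻ t, (∫⁻ r in Ioi (√3 * R), k r t) ∂cond volume (Icc 0 (2 * π)) := by
  have := isProbabilityMeasure_cond_Icc (show π / 2 < 3 * π / 2 by linarith [pi_pos])
  have := isProbabilityMeasure_cond_Icc (show 0 < 2 * π by linarith [pi_pos])
  have hnear : ∀ r ∈ Icc a (√3 * R), ∫⁻ t, k r t ∂orientationLaw R (z r) =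
      ∫⁻ t, k r t ∂cond volume (Icc (π / 2) (3 * π / 2)) := fun r hr => by
    rw [orientationLaw_of_norm_le ((hz r (ha₀.trans hr.1)).trans_le hr.2)]
  have hfar : ∀ r ∈ Ioi (√3 * R), ∫⁻ t, k r t ∂orientationLaw R (z r) =
      ∫⁻ t, k r t ∂cond volume (Icc 0 (2 * π)) := fun r hr => by
    rw [orientationLaw_of_lt_norm (hr.trans_eq (hz r ((ha₀.trans ha).trans (le_of_lt hr))).symm)]
  rw [← Icc_union_Ioi_eq_Ici ha, lintegral_union measurableSet_Ioi
      (disjoint_left.2 fun r hr hr' => hr.2.not_gt hr'),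
    setLIntegral_congr_fun measurableSet_Icc hnear, setLIntegral_congr_fun measurableSet_Ioi hfar,
    lintegral_lintegral_swap hk.aemeasurable, lintegral_lintegral_swap hk.aemeasurable]

end OrientationIntegrals

/-- The mean over the orientation and the distance of the loss caused by the devices in one
direction: a device with orientation `t` at distance `r` has relative mean power
`c t * r ^ (-η)`. -/
noncomputable def directionalLoss (η R : ℝ) (c : ℝ → ℝ) : ℝ :=
  π⁻¹ * (∫ t in (π / 2)..(3 * π / 2),
      (radialTail η (√3 * R / 2) (c t) - radialTail η (√3 * R) (c t))) +
    (2 * π)⁻¹ * ∫ t in (0)..(2 * π), radialTail η (√3 * R) (c t)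

section DirectionalLoss

variable {η R : ℝ} {c : ℝ → ℝ}

theorem integral_radialTail_sub_nonneg (hη : 2 < η) (hR : 0 < R) (hc₀ : ∀ t, 0 ≤ c t) :
    0 ≤ π⁻¹ * ∫ t in (π / 2)..(3 * π / 2),
      (radialTail η (√3 * R / 2) (c t) - radialTail η (√3 * R) (c t)) :=
  mul_nonneg (inv_nonneg.2 pi_nonneg) (intervalIntegral.integral_nonneg (by linarith [pi_pos])
    fun t _ => sub_nonneg.2
      (radialTail_anti hη (by positivity) (half_le_self (by positivity)) (hc₀ t)))

theorem integral_radialTail_nonneg (hη : 2 < η) (hR : 0 < R) (hc₀ : ∀ t, 0 ≤ c t) :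
    0 ≤ (2 * π)⁻¹ * ∫ t in (0)..(2 * π), radialTail η (√3 * R) (c t) :=
  mul_nonneg (inv_nonneg.2 two_pi_pos.le) (intervalIntegral.integral_nonneg two_pi_pos.le
    fun t _ => radialTail_nonneg hη (by positivity) (hc₀ t))

theorem directionalLoss_nonneg (hη : 2 < η) (hR : 0 < R) (hc₀ : ∀ t, 0 ≤ c t) :
    0 ≤ directionalLoss η R c :=
  add_nonneg (integral_radialTail_sub_nonneg hη hR hc₀) (integral_radialTail_nonneg hη hR hc₀)

theorem continuous_directionalLoss {X : Type*} [TopologicalSpace X] (hη : 2 < η) (hR : 0 < R)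
    {c : X → ℝ → ℝ} (hc : Continuous (Function.uncurry c)) (hc₀ : ∀ x t, 0 ≤ c x t) :
    Continuous fun x => directionalLoss η R (c x) := by
  have hfar : Continuous fun p : X × ℝ => radialTail η (√3 * R) (c p.1 p.2) :=
    continuous_radialTail hη (by positivity) hc fun p => hc₀ p.1 p.2
  have hnear : Continuous fun p : X × ℝ => radialTail η (√3 * R / 2) (c p.1 p.2) :=
    continuous_radialTail hη (by positivity) hc fun p => hc₀ p.1 p.2
  exact ((intervalIntegral.continuous_parametric_intervalIntegral_of_continuous'
    (hnear.sub hfar) _ _).const_mul _).add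
    ((intervalIntegral.continuous_parametric_intervalIntegral_of_continuous' hfar _ _).const_mul _)

theorem lintegral_Ici_eq_directionalLoss (hη : 2 < η) (hR : 0 < R) (hc : Continuous c)
    (hc₀ : ∀ t, 0 ≤ c t) {z : ℝ → ℂ} (hz : ∀ r, 0 ≤ r → ‖z r‖ = r) :
    ∫⁻ r in Ici (√3 * R / 2), ∫⁻ t, ENNReal.ofReal r *
        ENNReal.ofReal (c t * r ^ (-η) / (1 + c t * r ^ (-η))) ∂orientationLaw R (z r) =
      ENNReal.ofReal (directionalLoss η R c) := by
  have hA : 0 < √3 * R := by positivity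
  have hA2 : 0 < √3 * R / 2 := by positivity
  have hle : √3 * R / 2 ≤ √3 * R := half_le_self hA.le
  have hfar := continuous_radialTail hη hA hc hc₀
  have hnear := continuous_radialTail hη hA2 hc hc₀
  have hk : Measurable (Function.uncurry fun r t => ENNReal.ofReal r *
      ENNReal.ofReal (c t * r ^ (-η) / (1 + c t * r ^ (-η)))) := by
    unfold Function.uncurry
    fun_prop
  refine (lintegral_Ici_orientationLaw hA2.le hle hz hk).trans ?_
  simp only [lintegral_Icc_eq_radialTail_sub hη hA2 hle (hc₀ _),
    lintegral_Ioi_eq_radialTail hη hA (hc₀ _)]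
  rw [lintegral_cond_Icc_ofReal (by linarith [pi_pos]) (hnear.fun_sub hfar)
      fun t => sub_nonneg.2 (radialTail_anti hη hA2 hle (hc₀ t)),
    lintegral_cond_Icc_ofReal two_pi_pos hfar fun t => radialTail_nonneg hη hA (hc₀ t),
    show 3 * π / 2 - π / 2 = π by ring, sub_zero, directionalLoss,
    ENNReal.ofReal_add (integral_radialTail_sub_nonneg hη hR hc₀)
      (integral_radialTail_nonneg hη hR hc₀)]

end DirectionalLoss

section Plane

theorem lintegral_complex_eq_lintegral_polar {f : ℂ → ℝ≥0∞} (hf : Measurable f) :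
    ∫⁻ z, f z = ∫⁻ φ in Ioo (-π) π, ∫⁻ r in Ioi 0,
      ENNReal.ofReal r * f (Complex.polarCoord.symm (r, φ)) := by
  have hsymm : Measurable fun p : ℝ × ℝ => Complex.polarCoord.symm p := by
    simp only [Complex.polarCoord_symm_apply]
    fun_prop
  rw [← Complex.lintegral_comp_polarCoord_symm, polarCoord_target, Measure.volume_eq_prod,
    ← Measure.prod_restrict]
  exact lintegral_prod_symm' _ ((measurable_fst.ennreal_ofReal).mul (hf.comp hsymm))

theorem norm_polarCoord_symm {r : ℝ} (hr : 0 ≤ r) (φ : ℝ) :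
    ‖Complex.polarCoord.symm (r, φ)‖ = r := by
  rw [Complex.norm_polarCoord_symm, abs_of_nonneg hr]

theorem arg_polarCoord_symm {r φ : ℝ} (hr : 0 < r) (hφ : φ ∈ Ioo (-π) π) :
    (Complex.polarCoord.symm (r, φ)).arg = φ := by
  rw [Complex.polarCoord_symm_apply, Complex.ofReal_cos, Complex.ofReal_sin]
  exact Complex.arg_mul_cos_add_sin_mul_I hr ⟨hφ.1, hφ.2.le⟩

variable {T η R : ℝ} {G : ℝ → ℝ}

theorem lintegral_radius_relPower (hη : 2 < η) (hR : 0 < R) (hT : 0 ≤ T) (hG : Continuous G)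
    (hG₀ : ∀ t, 0 ≤ G t) (φ₀ : ℝ) {φ : ℝ} (hφ : φ ∈ Ioo (-π) π) :
    ∫⁻ r in Ioi (0 : ℝ), ENNReal.ofReal r * ∫⁻ t, ENNReal.ofReal
        (relPower T η (√3 * R / 2) G φ₀ (Complex.polarCoord.symm (r, φ), t) /
          (1 + relPower T η (√3 * R / 2) G φ₀ (Complex.polarCoord.symm (r, φ), t)))
        ∂orientationLaw R (Complex.polarCoord.symm (r, φ)) =
      ENNReal.ofReal (directionalLoss η R fun t => T * G (φ - φ₀) * G t) := by
  have hA2 : 0 < √3 * R / 2 := by positivity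
  have hrel : ∀ r ∈ Ioi (0 : ℝ), ∀ t, relPower T η (√3 * R / 2) G φ₀
      (Complex.polarCoord.symm (r, φ), t) =
        (Ici (√3 * R / 2)).indicator (fun r => T * G (φ - φ₀) * G t * r ^ (-η)) r := by
    intro r hr t
    simp only [relPower, indicator_apply, mem_ofPred_eq, mem_Ici,
      norm_polarCoord_symm (le_of_lt hr), arg_polarCoord_symm hr hφ]
  rw [← lintegral_Ici_eq_directionalLoss hη hR (by fun_prop)
      (fun t => mul_nonneg (mul_nonneg hT (hG₀ _)) (hG₀ t)) fun r hr => norm_polarCoord_symm hr φ,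
    ← inter_eq_left.2 (Ici_subset_Ioi.2 hA2), ← Measure.restrict_restrict measurableSet_Ici,
    ← lintegral_indicator measurableSet_Ici]
  refine setLIntegral_congr_fun measurableSet_Ioi fun r hr => ?_
  by_cases hmem : r ∈ Ici (√3 * R / 2)
  · simp only [hrel r hr, indicator_of_mem hmem]
    exact (lintegral_const_mul' _ _ ENNReal.ofReal_ne_top).symm
  · simp only [hrel r hr, indicator_of_notMem hmem, zero_div, ENNReal.ofReal_zero,
      lintegral_zero, mul_zero]

theorem lintegral_plane_relPower (hη : 2 < η) (hR : 0 < R) (hT : 0 ≤ T) (hG : Continuous G)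
    (hG₀ : ∀ t, 0 ≤ G t) (hGper : Function.Periodic G (2 * π)) (φ₀ : ℝ) :
    ∫⁻ z, ∫⁻ t, ENNReal.ofReal (relPower T η (√3 * R / 2) G φ₀ (z, t) /
        (1 + relPower T η (√3 * R / 2) G φ₀ (z, t))) ∂orientationLaw R z =
      ENNReal.ofReal (∫ ψ in (0)..(2 * π), directionalLoss η R fun t => T * G ψ * G t) := by
  have hrel := measurable_relPower (T := T) (η := η) (a := √3 * R / 2) (φ₀ := φ₀) hG.measurable
  have hloss : Measurable fun z => ∫⁻ t, ENNReal.ofReal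
      (relPower T η (√3 * R / 2) G φ₀ (z, t) / (1 + relPower T η (√3 * R / 2) G φ₀ (z, t)))
        ∂orientationLaw R z := by
    rw [← coe_orientationKernel]
    exact (hrel.div (hrel.const_add 1)).ennreal_ofReal.lintegral_kernel_prod_right'
  have hc₀ : ∀ ψ t, 0 ≤ T * G ψ * G t := fun ψ t => mul_nonneg (mul_nonneg hT (hG₀ ψ)) (hG₀ t)
  have hcont : Continuous fun ψ => directionalLoss η R fun t => T * G ψ * G t :=
    continuous_directionalLoss hη hR (by unfold Function.uncurry; fun_prop) hc₀
  have hper : Function.Periodic (fun ψ => directionalLoss η R fun t => T * G ψ * G t) (2 * π) :=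
    fun ψ => by simp only [hGper ψ]
  rw [lintegral_complex_eq_lintegral_polar hloss, setLIntegral_congr_fun measurableSet_Ioo
      fun φ hφ => lintegral_radius_relPower hη hR hT hG hG₀ φ₀ hφ,
    setLIntegral_congr Ioo_ae_eq_Icc, setLIntegral_Icc_ofReal (by linarith [pi_pos])
      (show Continuous fun φ => directionalLoss η R fun t => T * G (φ - φ₀) * G t from
        hcont.comp (continuous_sub_right φ₀)) fun φ => directionalLoss_nonneg hη hR (hc₀ _),
    intervalIntegral.integral_comp_sub_right fun ψ => directionalLoss η R fun t => T * G ψ * G t,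
    show π - φ₀ = -π - φ₀ + 2 * π by ring, hper.intervalIntegral_add_eq (-π - φ₀) 0, zero_add]

end Plane

section ClosedForm

theorem sinrThreshold_pos {ζ W rate : ℝ} (hζ : 0 < ζ) (hW : 0 < W) (hrate : 0 < rate) :
    0 < sinrThreshold ζ W rate :=
  sub_pos.2 (one_lt_rpow one_lt_two (by positivity))

theorem txRate_pos {L Ts : ℝ} {m : ℕ} (hL : 0 < L) (hm : 0 < m) (hTs : 0 < Ts) :
    0 < txRate L m Ts := by
  have : (0 : ℝ) < m := Nat.cast_pos.2 hm
  unfold txRate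
  positivity

theorem activeDensity_pos {Δx Δy : ℝ} {NG : ℕ} (hΔx : 0 < Δx) (hΔy : 0 < Δy) (hNG : 0 < NG) :
    0 < activeDensity Δx Δy NG := by
  unfold activeDensity
  positivity

theorem div_two_rpow_two_sub {a : ℝ} (ha : 0 ≤ a) (η : ℝ) :
    (a / 2) ^ (2 - η) = a ^ (2 - η) * 2 ^ η / 4 := by
  rw [div_rpow ha zero_le_two, rpow_sub two_pos, rpow_two, div_div_eq_mul_div]
  norm_num

theorem directionalLoss_const_mul {η R : ℝ} (hη : 2 < η) (hR : 0 < R) (q : ℝ) (f : ℝ → ℝ) :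
    directionalLoss η R (fun t => q * f t) =
      q * (√3 * R) ^ (2 - η) / (4 * π * (η - 2)) *
        ((∫ t in (0)..(2 * π), 2 * f t * hyp η (-(q * f t) / (√3 * R) ^ η)) +
          ∫ t in (π / 2)..(3 * π / 2), f t * (2 ^ η * hyp η (-(q * f t) / (√3 * R / 2) ^ η) -
            4 * hyp η (-(q * f t) / (√3 * R) ^ η))) := by
  set k : ℝ := q * (√3 * R) ^ (2 - η) / (η - 2) with hk
  have hfar : ∀ t, radialTail η (√3 * R) (q * f t) =
      k / 2 * (2 * f t * hyp η (-(q * f t) / (√3 * R) ^ η)) := fun t => by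
    rw [radialTail, hk]
    ring
  have hnear : ∀ t, radialTail η (√3 * R / 2) (q * f t) - radialTail η (√3 * R) (q * f t) =
      k / 4 * (f t * (2 ^ η * hyp η (-(q * f t) / (√3 * R / 2) ^ η) -
        4 * hyp η (-(q * f t) / (√3 * R) ^ η))) := fun t => by
    rw [radialTail, radialTail, div_two_rpow_two_sub (by positivity), hk]
    ring
  have hη' : η - 2 ≠ 0 := by linarith
  simp only [directionalLoss, hnear]
  simp only [hfar]
  rw [intervalIntegral.integral_const_mul, intervalIntegral.integral_const_mul, hk]
  field_simp
  ring

theorem activeDensity_mul_directionalLoss {Δx Δy η R g₀ : ℝ} {NG : ℕ} (hη : 2 < η) (hR : 0 < R)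
    (S b : ℝ) (n : ℕ) (ψ : ℝ) :
    activeDensity Δx Δy NG *
        directionalLoss η R (fun t => S / g₀ * gain b n ψ * gain b n t) =
      S * gain b n ψ * (√3 * R) ^ (2 - η) / (4 * g₀ * π * (η - 2) * Δx * Δy * NG) *
        ((∫ t in (0)..(2 * π), 2 * gain b n t *
            hyp η (-(S * gain b n t * gain b n ψ) / (g₀ * (√3 * R) ^ η))) +
          ∫ t in (π / 2)..(3 * π / 2), gain b n t *
            (2 ^ η * hyp η (-(S * gain b n t * gain b n ψ) / (g₀ * (√3 * R / 2) ^ η)) -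
              4 * hyp η (-(S * gain b n t * gain b n ψ) / (g₀ * (√3 * R) ^ η)))) := by
  have harg : ∀ t d : ℝ, -(S / g₀ * gain b n ψ * gain b n t) / d =
      -(S * gain b n t * gain b n ψ) / (g₀ * d) := fun t d => by ring
  rw [directionalLoss_const_mul hη hR, activeDensity]
  simp only [harg]
  simp only [div_eq_mul_inv, mul_inv]
  ring

end ClosedForm

end IoTUplink

open IoTUplink in
theorem theorem2_general {Ω : Type*} [MeasurableSpace Ω] (μ : Measure Ω) [IsProbabilityMeasure μ]
    (Δx Δy R : ℝ) (NG : ℕ) (hΔx : 0 < Δx) (hΔy : 0 < Δy) (hR : 0 < R) (hNG : 0 < NG)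
    (η b : ℝ) (n : ℕ) (P σ r₀ φ₀ : ℝ) (hη : 2 < η) (hb₀ : -1 < b) (hb₁ : b ≤ 1)
    (hP : 0 < P) (hr₀ : 0 < r₀) (Ξ : ℝ) (hΞ : 0 < Ξ)
    (v : ℕ → Ω → ℂ) (θ h : ℕ → Ω → ℝ) (h₀ : Ω → ℝ)
    (hmodel : IsPoissonModel μ (activeDensity Δx Δy NG) R v θ h h₀) :
    successProb μ Ξ P σ η R b n φ₀ r₀ v θ h h₀ =
      successFormula (gain b n 0 * gain b n 0) Ξ P σ η R b n r₀ Δx Δy NG := by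
  have hb : |b| ≤ 1 := abs_le.2 ⟨hb₀.le, hb₁⟩
  have hg : 0 < gain b n 0 := by
    rw [gain_zero]
    linarith
  have hs : 0 ≤ Ξ * r₀ ^ η / (gain b n 0 * gain b n 0 * P) := by positivity
  have hsP : Ξ * r₀ ^ η / (gain b n 0 * gain b n 0 * P) * P =
      Ξ * r₀ ^ η / (gain b n 0 * gain b n 0) := by field_simp
  have hT : 0 ≤ Ξ * r₀ ^ η / (gain b n 0 * gain b n 0) := by positivity
  have hlam : 0 ≤ activeDensity Δx Δy NG := (activeDensity_pos hΔx hΔy hNG).le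
  have hnoise : 0 ≤ Ξ * r₀ ^ η * σ ^ 2 / (gain b n 0 * gain b n 0 * P) := by positivity
  have hloss : 0 ≤ ∫ ψ in (0)..(2 * π), directionalLoss η R fun t =>
      Ξ * r₀ ^ η / (gain b n 0 * gain b n 0) * gain b n ψ * gain b n t :=
    intervalIntegral.integral_nonneg two_pi_pos.le fun ψ _ => directionalLoss_nonneg hη hR
      fun t => mul_nonneg (mul_nonneg hT (gain_nonneg hb n ψ)) (gain_nonneg hb n t)
  rw [successProb, measureReal_def, hmodel.measure_lt_sinr hΞ hP hg hr₀,
    hmodel.lintegral_expNeg_interference hs hP.le hb, hsP,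
    lintegral_plane_relPower hη hR hT (continuous_gain b n) (gain_nonneg hb n)
      (periodic_gain b n) φ₀,
    ← ENNReal.ofReal_mul hlam, ← expNeg_add, ← ENNReal.ofReal_add hnoise (mul_nonneg hlam hloss),
    expNeg_ofReal (add_nonneg hnoise (mul_nonneg hlam hloss)),
    ENNReal.toReal_ofReal (exp_pos _).le, successFormula, neg_add',
    ← intervalIntegral.integral_const_mul]
  simp only [activeDensity_mul_directionalLoss hη hR]

theorem theorem2 {Ω : Type*} [MeasurableSpace Ω] (μ : MeasureTheory.Measure Ω)
    [MeasureTheory.IsProbabilityMeasure μ]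
    -- geometry of the network
    (Δx Δy R : ℝ) (NG : ℕ) (hΔx : 0 < Δx) (hΔy : 0 < Δy) (hR : 0 < R) (hNG : 0 < NG)
    -- path loss, antennas, transmit power, noise, position of the intended device
    (η b : ℝ) (n : ℕ) (P σ r₀ φ₀ : ℝ) (hη : 2 < η) (hb₀ : 0 ≤ b) (hb₁ : b ≤ 1)
    (hP : 0 < P) (hr₀ : 0 < r₀)
    -- segmentation and rate
    (L Ts ζ W : ℝ) (m : ℕ) (hL : 0 < L) (hTs : 0 < Ts) (hζ : 0 < ζ) (hW : 0 < W) (hm : 0 < m)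
    -- locations, orientations and fading gains
    (v : ℕ → Ω → ℂ) (θ h : ℕ → Ω → ℝ) (h₀ : Ω → ℝ)
    (hmodel : IoTUplink.IsPoissonModel μ (IoTUplink.activeDensity Δx Δy NG) R v θ h h₀) :
    IoTUplink.successProb μ (IoTUplink.sinrThreshold ζ W (IoTUplink.txRate L m Ts))
        P σ η R b n φ₀ r₀ v θ h h₀ =
      IoTUplink.successFormula (IoTUplink.gain b n 0 * IoTUplink.gain b n 0)
        (IoTUplink.sinrThreshold ζ W (IoTUplink.txRate L m Ts)) P σ η R b n r₀ Δx Δy NG ∧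
    (b = 1 →
      IoTUplink.successProb μ (IoTUplink.sinrThreshold ζ W (IoTUplink.txRate L m Ts))
          P σ η R b n φ₀ r₀ v θ h h₀ =
        IoTUplink.successFormula 4
          (IoTUplink.sinrThreshold ζ W (IoTUplink.txRate L m Ts)) P σ η R b n r₀ Δx Δy NG) := by
  have hmain := theorem2_general μ Δx Δy R NG hΔx hΔy hR hNG η b n P σ r₀ φ₀ hη
    (by linarith) hb₁ hP hr₀ _ (IoTUplink.sinrThreshold_pos hζ hW (IoTUplink.txRate_pos hL hm hTs))
    v θ h h₀ hmodel
  have hfour : b = 1 → IoTUplink.gain b n 0 * IoTUplink.gain b n 0 = 4 := by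
    rintro rfl
    rw [IoTUplink.gain_zero]
    norm_num
  exact ⟨hmain, fun hb => hfour hb ▸ hmain⟩
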